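/- Let $m,n\ge 0$ be integers and $I=\{1,\dots,m+n-1\}$ (empty if $m+n\le 1$). For $i,j\in I$ put $i\bullet i=2$ if $i<m$, $i\bullet i=-2$ if $i>m$, $m\bullet m=0$; if $|i-j|=1$, put $i\bullet j=-1$ if $i<m$ or $j<m$, and $i\bullet j=1$ if $i>m$ or $j>m$; and $i\bullet j=0$ if $|i-j|>1$. Let $p(i)=0\in\mathbb Z/2$ for $i\ne m$ and $p(m)=1$. Extend $\bullet$ bilinearly and $p$ additively to $\mathbb N[I]$. Let $\mathbf f'$ be the free associative $\mathbb Q(q)$-algebra with $1$ on generators $\theta_i$, $i\in I$, graded by $\mathbb N[I]$ with $|\theta_i|=i$, and with parity $p(x)=p(|x|)$ for homogeneous $x$. Give $\mathbf f'\otimes\mathbf f'$ the associative product $$(x_1\otimes x_2)(x_1'\otimes x_2')=q^{-|x_2|\bullet|x_1'|}(-1)^{p(x_2)p(x_1')}\,x_1x_1'\otimes x_2x_2'$$ ($x_2$, $x_1'$ homogeneous), and let $\Delta:\mathbf f'\to\mathbf f'\otimes\mathbf f'$ be the algebra homomorphism with $\Delta(\theta_i)=\theta_i\otimes1+1\otimes\theta_i$.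 There is a unique bilinear form $(\,,)$ on $\mathbf f'$ with values in $\mathbb Q(q)$ such that $(1,1)=1$, $(x,y'y'')=(\Delta(x),y'\otimes y'')$, $(x'x'',y)=(x'\otimes x'',\Delta(y))$, $(\theta_i,\theta_i)=\frac1{1-q^{i\bullet i}}$ for $i\neq m$, $(\theta_m,\theta_m)=1$ if $m\in I$, and $(\theta_i,\theta_j)=0$ for $i\ne j$, where $(x'\otimes x'',y'\otimes y'')=(x',y')(x'',y'')$. Let $\mathcal I=\{x\in\mathbf f' : (x,y)=0\text{ for all }y\in\mathbf f'\}$ be its radical, which is a two-sided ideal, and let $\mathbf f=\mathbf f'/\mathcal I$. Let $\Delta^+$ be the set of positive roots $\alpha_i+\dots+\alpha_j$ with $i\le j$ in $I$; identify $\alpha_i$ with $i\in\mathbb N[I]$, so that $p(\alpha)$ and $\alpha\bullet\beta$ are defined for roots. Order $\Delta^+$ lexicographically: $$\alpha_1<\alpha_1+\alpha_2<\dots<\alpha_1+\dots+\alpha_{m+n-1}<\alpha_2<\alpha_2+\alpha_3<\dots<\alpha_{m+n-1}.$$ Define root vectors in $\mathbf f'$ by $\theta_{\alpha_i}=\theta_i$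 and, for $i<j$, $\alpha=\alpha_i+\dots+\alpha_j$ and $\alpha'=\alpha_i+\dots+\alpha_{j-1}$, $$\theta_\alpha=\theta_{\alpha'}\theta_j-(-1)^{p(\alpha')p(\alpha_j)}q^{\alpha'\bullet\alpha_j}\theta_j\theta_{\alpha'}.$$ Let $\mathcal J$ be the two-sided ideal of $\mathbf f'$ generated by the following elements (whenever all the indices that occur lie in $I$): (a) $(q+q^{-1})\theta_m\theta_{m-1}\theta_{m+1}\theta_m-\theta_{m-1}\theta_m\theta_{m+1}\theta_m-\theta_m\theta_{m-1}\theta_m\theta_{m+1}-\theta_m\theta_{m+1}\theta_m\theta_{m-1}-\theta_{m+1}\theta_m\theta_{m-1}\theta_m$; (b) $\theta_m^2$; (c) $\theta_i\theta_j-\theta_j\theta_i$ for $|i-j|>1$; (d) $(q+q^{-1})\theta_i\theta_{i\pm1}\theta_i-\theta_i^2\theta_{i\pm1}-\theta_{i\pm1}\theta_i^2$ for $i\ne m$. Then: (1) The images in $\mathbf f$ of the ordered products $\prod^{<}_{\alpha\in\Delta^+}\theta_\alpha^{n_\alpha}$ (factors in increasing order of $\alpha$ from left to right), where $n_\alpha\in\mathbb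 N$ if $p(\alpha)=0$ and $n_\alpha\in\{0,1\}$ if $p(\alpha)=1$, form a $\mathbb Q(q)$-basis of $\mathbf f$; distinct exponent families give distinct basis elements. (2) $\mathcal I=\mathcal J$. -/

import Mathlib

open scoped TensorProduct

noncomputable section

namespace SuperPBW

/-- The field `ℚ(q)`. -/
abbrev Kq : Type := RatFunc ℚ

/-- The indeterminate `q`. -/
def q : Kq := RatFunc.X

/-- The index set `I = {1, …, m+n-1}` (empty if `m + n ≤ 1`). -/
abbrev Idx (m n : ℕ) : Type := {i : ℕ // i ∈ Finset.Icc 1 (m + n - 1)}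

/-- The integers `i • j`, with `I' = {i < m}` and `I'' = {i > m}`. Two distinct neighbours `i, j`
never both equal `m`, so the last alternative for neighbours is the case `i ∈ I''` or `j ∈ I''`. -/
def dot (m i j : ℕ) : ℤ :=
  if i = j then (if i < m then 2 else if m < i then -2 else 0)
  else if i + 1 = j ∨ j + 1 = i then (if i < m ∨ j < m then -1 else 1)
  else 0

/-- The bilinear extension of `•` to `ℕ[I]`. -/
def bullet {m n : ℕ} (μ ν : Idx m n → ℕ) : ℤ :=
  ∑ i, ∑ j, (μ i : ℤ) * (ν j : ℤ) * dot m i j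

/-- The parity `p : ℕ[I] → ℤ/2`: the additive map with `p(i) = 0` for `i ≠ m` and `p(m) = 1`. -/
def parity {m n : ℕ} (ν : Idx m n → ℕ) : ZMod 2 :=
  ∑ i, (ν i : ZMod 2) * (if (i : ℕ) = m then 1 else 0)

/-- The scalar `(-1)^ε` for `ε ∈ ℤ/2`. -/
def sgn (ε : ZMod 2) : Kq := (-1) ^ ε.val

/-- The free algebra `f'` on `θ_i`, `i ∈ I`. -/
abbrev FPrime (m n : ℕ) : Type := FreeAlgebra Kq (Idx m n)

/-- The generator `θ_i`. -/
def θ {m n : ℕ} (i : Idx m n) : FPrime m n := FreeAlgebra.ι Kq i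

/-- The monomial `θ_{i₁} ⋯ θ_{i_r}` of a word. -/
def monomial {m n : ℕ} : FreeMonoid (Idx m n) →* FPrime m n := FreeMonoid.lift θ

/-- The weight `|θ_{i₁} ⋯ θ_{i_r}| ∈ ℕ[I]` of a monomial. -/
def weight {m n : ℕ} (w : FreeMonoid (Idx m n)) : Idx m n → ℕ := fun i => w.toList.count i

/-- The subspace `f'_ν` spanned by the monomials of weight `ν`. -/
def weightSpace {m n : ℕ} (ν : Idx m n → ℕ) : Submodule Kq (FPrime m n) :=
  Submodule.span Kq (monomial '' {w | weight w = ν})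

/-- The scalar `q^{-μ • ν} (-1)^{p(μ) p(ν)}`. -/
def twist {m n : ℕ} (μ ν : Idx m n → ℕ) : Kq :=
  q ^ (-bullet μ ν) * sgn (parity μ * parity ν)

/-! ### The twisted superalgebra `f' ⊗ f'` -/

/-- The vector space `f' ⊗ f'`, which carries the twisted multiplication below. -/
def TwistedSquare (m n : ℕ) : Type := FPrime m n ⊗[Kq] FPrime m n

instance (m n : ℕ) : AddCommGroup (TwistedSquare m n) :=
  inferInstanceAs (AddCommGroup (FPrime m n ⊗[Kq] FPrime m n))

instance (m n : ℕ) : Module Kq (TwistedSquare m n) :=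
  inferInstanceAs (Module Kq (FPrime m n ⊗[Kq] FPrime m n))

/-- The identity map from `f' ⊗ f'` to the twisted square. -/
def toTwisted (m n : ℕ) : (FPrime m n ⊗[Kq] FPrime m n) ≃ₗ[Kq] TwistedSquare m n :=
  LinearEquiv.refl Kq _

/-- The element `x ⊗ y` of the twisted square. -/
def tens {m n : ℕ} (x y : FPrime m n) : TwistedSquare m n := toTwisted m n (x ⊗ₜ[Kq] y)

/-- The basis of `f' ⊗ f'` consisting of tensor products of two monomials. -/
def pairBasis (m n : ℕ) :
    Module.Basis (FreeMonoid (Idx m n) × FreeMonoid (Idx m n)) Kq (TwistedSquare m n) :=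
  ((FreeAlgebra.basisFreeMonoid Kq (Idx m n)).tensorProduct
    (FreeAlgebra.basisFreeMonoid Kq (Idx m n))).map (toTwisted m n)

/-- The multiplication
`(x₁ ⊗ x₂)(y₁ ⊗ y₂) = q^{-|x₂| • |y₁|} (-1)^{p(x₂) p(y₁)} x₁ y₁ ⊗ x₂ y₂`,
given on monomials and extended bilinearly. -/
def twMul (m n : ℕ) :
    TwistedSquare m n →ₗ[Kq] TwistedSquare m n →ₗ[Kq] TwistedSquare m n :=
  (pairBasis m n).constr Kq fun x => (pairBasis m n).constr Kq fun y =>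
    twist (weight x.2) (weight y.1) •
      tens (monomial x.1 * monomial y.1) (monomial x.2 * monomial y.2)

section lemmas

variable {m n : ℕ}

lemma q_ne_zero : q ≠ 0 := RatFunc.X_ne_zero

lemma weight_one : weight (1 : FreeMonoid (Idx m n)) = 0 := by
  funext i; simp [weight]

lemma weight_mul (u v : FreeMonoid (Idx m n)) : weight (u * v) = weight u + weight v := by
  funext i; simp [weight]

lemma sgn_add (a b : ZMod 2) : sgn (a + b) = sgn a * sgn b := by
  have h : ∀ a b : ZMod 2, (a + b).val = (a.val + b.val) % 2 := by decide
  rw [sgn, h, ← neg_one_pow_eq_pow_mod_two, pow_add, sgn, sgn]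

lemma sgn_zero : sgn 0 = 1 := by simp [sgn]

lemma bullet_add_left (μ μ' ν : Idx m n → ℕ) :
    bullet (μ + μ') ν = bullet μ ν + bullet μ' ν := by
  simp only [bullet, ← Finset.sum_add_distrib]
  refine Finset.sum_congr rfl fun i _ => Finset.sum_congr rfl fun j _ => ?_
  simp only [Pi.add_apply]; push_cast; ring

lemma bullet_add_right (μ ν ν' : Idx m n → ℕ) :
    bullet μ (ν + ν') = bullet μ ν + bullet μ ν' := by
  simp only [bullet, ← Finset.sum_add_distrib]
  refine Finset.sum_congr rfl fun i _ => Finset.sum_congr rfl fun j _ => ?_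
  simp only [Pi.add_apply]; push_cast; ring

lemma parity_add (μ ν : Idx m n → ℕ) : parity (μ + ν) = parity μ + parity ν := by
  simp only [parity, ← Finset.sum_add_distrib]
  refine Finset.sum_congr rfl fun i _ => ?_
  simp only [Pi.add_apply]; push_cast; ring

lemma twist_add_left (μ μ' ν : Idx m n → ℕ) :
    twist (μ + μ') ν = twist μ ν * twist μ' ν := by
  simp only [twist, bullet_add_left, parity_add, add_mul, sgn_add, neg_add,
    zpow_add₀ q_ne_zero]
  ring

lemma twist_add_right (μ ν ν' : Idx m n → ℕ) :
    twist μ (ν + ν') = twist μ ν * twist μ ν' := by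
  simp only [twist, bullet_add_right, parity_add, mul_add, sgn_add, neg_add,
    zpow_add₀ q_ne_zero]
  ring

lemma twist_zero_left (ν : Idx m n → ℕ) : twist 0 ν = 1 := by
  simp [twist, bullet, parity, sgn_zero]

lemma twist_zero_right (μ : Idx m n → ℕ) : twist μ 0 = 1 := by
  simp [twist, bullet, parity, sgn_zero]

lemma basisFreeMonoid_eq (w : FreeMonoid (Idx m n)) :
    FreeAlgebra.basisFreeMonoid Kq (Idx m n) w = monomial w := by
  simp [FreeAlgebra.basisFreeMonoid, FreeAlgebra.equivMonoidAlgebraFreeMonoid, monomial]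
  rfl

lemma pairBasis_eq (x : FreeMonoid (Idx m n) × FreeMonoid (Idx m n)) :
    pairBasis m n x = tens (monomial x.1) (monomial x.2) := by
  rw [pairBasis, Module.Basis.map_apply, Module.Basis.tensorProduct_apply', basisFreeMonoid_eq,
    basisFreeMonoid_eq, tens]

lemma twMul_monomial (a b c d : FreeMonoid (Idx m n)) :
    twMul m n (tens (monomial a) (monomial b)) (tens (monomial c) (monomial d)) =
      twist (weight b) (weight c) • tens (monomial (a * c)) (monomial (b * d)) := by
  rw [← pairBasis_eq (a, b), ← pairBasis_eq (c, d), twMul, Module.Basis.constr_basis,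
    Module.Basis.constr_basis, map_mul, map_mul]

lemma twMul_assoc (x y z : TwistedSquare m n) :
    twMul m n (twMul m n x y) z = twMul m n x (twMul m n y z) := by
  have h1 (a b z) : twMul m n (twMul m n (pairBasis m n a) (pairBasis m n b)) z =
      twMul m n (pairBasis m n a) (twMul m n (pairBasis m n b) z) := by
    suffices h : twMul m n (twMul m n (pairBasis m n a) (pairBasis m n b)) =
        twMul m n (pairBasis m n a) ∘ₗ twMul m n (pairBasis m n b) from LinearMap.congr_fun h z
    refine (pairBasis m n).ext fun c => ?_
    simp only [pairBasis_eq, LinearMap.comp_apply, twMul_monomial, map_smul, LinearMap.smul_apply,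
      weight_mul, twist_add_left, twist_add_right, smul_smul, mul_assoc]
    congr 1
    ring
  have h2 (a y z) : twMul m n (twMul m n (pairBasis m n a) y) z =
      twMul m n (pairBasis m n a) (twMul m n y z) := by
    suffices h : (twMul m n).flip z ∘ₗ twMul m n (pairBasis m n a) =
        twMul m n (pairBasis m n a) ∘ₗ (twMul m n).flip z from LinearMap.congr_fun h y
    exact (pairBasis m n).ext fun b => h1 a b z
  suffices h : (twMul m n).flip z ∘ₗ (twMul m n).flip y = (twMul m n).flip (twMul m n y z) from
    LinearMap.congr_fun h x
  exact (pairBasis m n).ext fun a => h2 a y z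

lemma one_twMul (x : TwistedSquare m n) : twMul m n (tens 1 1) x = x := by
  suffices h : twMul m n (tens 1 1) = LinearMap.id by rw [h]; rfl
  refine (pairBasis m n).ext fun ⟨a, b⟩ => ?_
  rw [pairBasis_eq, ← map_one monomial, twMul_monomial]
  simp [weight_one, twist_zero_left]

lemma twMul_one (x : TwistedSquare m n) : twMul m n x (tens 1 1) = x := by
  suffices h : (twMul m n).flip (tens 1 1) = LinearMap.id by
    rw [← LinearMap.flip_apply, h]; rfl
  refine (pairBasis m n).ext fun ⟨a, b⟩ => ?_
  rw [pairBasis_eq, ← map_one monomial, LinearMap.flip_apply, twMul_monomial]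
  simp [weight_one, twist_zero_right]

end lemmas

instance (m n : ℕ) : Ring (TwistedSquare m n) :=
  { (inferInstance : AddCommGroup (TwistedSquare m n)) with
    mul := fun x y => twMul m n x y
    one := tens 1 1
    mul_assoc := twMul_assoc
    one_mul := one_twMul
    mul_one := twMul_one
    left_distrib := fun x y z => map_add (twMul m n x) y z
    right_distrib := fun x y z => LinearMap.map_add₂ (twMul m n) x y z
    zero_mul := fun x => LinearMap.map_zero₂ (twMul m n) x
    mul_zero := fun x => map_zero (twMul m n x) }

instance (m n : ℕ) : Algebra Kq (TwistedSquare m n) :=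
  Algebra.ofModule (fun r x y => LinearMap.map_smul₂ (twMul m n) r x y)
    (fun r x y => map_smul (twMul m n x) r y)

/-- On homogeneous elements the product is the one of the displayed formula. -/
lemma tens_mul_tens {m n : ℕ} {μ ν : Idx m n → ℕ} {x₂ y₁ : FPrime m n}
    (hx : x₂ ∈ weightSpace μ) (hy : y₁ ∈ weightSpace ν) (x₁ y₂ : FPrime m n) :
    tens x₁ x₂ * tens y₁ y₂ =
      (q ^ (-bullet μ ν) * sgn (parity μ * parity ν)) • tens (x₁ * y₁) (x₂ * y₂) := by
  have hspan (x : FPrime m n) : x ∈ Submodule.span Kq (Set.range (monomial (m := m) (n := n))) := by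
    have h := (FreeAlgebra.basisFreeMonoid Kq (Idx m n)).mem_span x
    rwa [show ⇑(FreeAlgebra.basisFreeMonoid Kq (Idx m n)) = monomial from
      funext basisFreeMonoid_eq] at h
  change twMul m n (tens x₁ x₂) (tens y₁ y₂) = twist μ ν • tens (x₁ * y₁) (x₂ * y₂)
  induction hspan x₁ using Submodule.span_induction with
  | zero => simp [tens]
  | add a b _ _ ha hb => simp_all [tens, TensorProduct.add_tmul, add_mul]
  | smul r a _ ha => simp_all [tens, ← TensorProduct.smul_tmul', smul_comm r]
  | mem a ha =>
  induction hspan y₂ using Submodule.span_induction with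
  | zero => simp [tens]
  | add a b _ _ ha hb => simp_all [tens, TensorProduct.tmul_add, mul_add]
  | smul r a _ ha => simp_all [tens, smul_comm r]
  | mem b hb =>
  induction hx using Submodule.span_induction with
  | zero => simp [tens]
  | add a b _ _ ha hb => simp_all [tens, TensorProduct.tmul_add, add_mul]
  | smul r a _ ha => simp_all [tens, smul_comm r]
  | mem c hc =>
  induction hy using Submodule.span_induction with
  | zero => simp [tens]
  | add a b _ _ ha hb => simp_all [tens, TensorProduct.add_tmul, mul_add]
  | smul r a _ ha => simp_all [tens, ← TensorProduct.smul_tmul', smul_comm r]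
  | mem d hd =>
  obtain ⟨a, rfl⟩ := ha
  obtain ⟨b, rfl⟩ := hb
  obtain ⟨c, rfl, rfl⟩ := hc
  obtain ⟨d, rfl, rfl⟩ := hd
  rw [twMul_monomial, map_mul, map_mul]

/-- The comultiplication: the algebra homomorphism `Δ : f' → f' ⊗ f'` into the twisted square with
`Δ(θ_i) = θ_i ⊗ 1 + 1 ⊗ θ_i`. -/
def Δ (m n : ℕ) : FPrime m n →ₐ[Kq] TwistedSquare m n :=
  FreeAlgebra.lift Kq fun i => tens (θ i) 1 + tens 1 (θ i)

/-! ### The bilinear form and its radical -/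

/-- The form on `f' ⊗ f'` induced by a form on `f'`:
`(x' ⊗ x'', y' ⊗ y'') = (x', y') (x'', y'')`. -/
def squareForm {m n : ℕ} (B : LinearMap.BilinForm Kq (FPrime m n)) :
    LinearMap.BilinForm Kq (TwistedSquare m n) :=
  (LinearMap.BilinForm.tmul B B).compl₁₂ (toTwisted m n).symm.toLinearMap
    (toTwisted m n).symm.toLinearMap

lemma squareForm_tens {m n : ℕ} (B : LinearMap.BilinForm Kq (FPrime m n))
    (x' x'' y' y'' : FPrime m n) :
    squareForm B (tens x' x'') (tens y' y'') = B x' y' * B x'' y'' := by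
  simp [squareForm, tens, mul_comm]

/-- The defining properties of the bilinear form `( , )` on `f'`. -/
structure IsLusztigForm {m n : ℕ} (B : LinearMap.BilinForm Kq (FPrime m n)) : Prop where
  one_one : B 1 1 = 1
  mul_right : ∀ x y' y'', B x (y' * y'') = squareForm B (Δ m n x) (tens y' y'')
  mul_left : ∀ x' x'' y, B (x' * x'') y = squareForm B (tens x' x'') (Δ m n y)
  theta_self : ∀ i : Idx m n, (i : ℕ) ≠ m → B (θ i) (θ i) = 1 / (1 - q ^ dot m i i)
  theta_odd : ∀ i : Idx m n, (i : ℕ) = m → B (θ i) (θ i) = 1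
  theta_ne : ∀ i j : Idx m n, i ≠ j → B (θ i) (θ j) = 0

lemma squareForm_eq_zero {m n : ℕ} (B : LinearMap.BilinForm Kq (FPrime m n))
    {x' x'' : FPrime m n} (h : B x' = 0 ∨ B x'' = 0) (t : TwistedSquare m n) :
    squareForm B (tens x' x'') t = 0 := by
  suffices h' : squareForm B (tens x' x'') = 0 by rw [h']; rfl
  refine (pairBasis m n).ext fun c => ?_
  rw [pairBasis_eq, squareForm_tens]
  rcases h with h | h <;> simp [h]

/-- The radical `{x ∈ f' | (x, y) = 0 for all y ∈ f'}` of the form, a two-sided ideal. -/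
def radical {m n : ℕ} {B : LinearMap.BilinForm Kq (FPrime m n)} (hB : IsLusztigForm B) :
    TwoSidedIdeal (FPrime m n) :=
  .mk' {x | ∀ y, B x y = 0}
    (fun y => by simp)
    (fun {x y} hx hy z => by simp [hx z, hy z])
    (fun {x} hx z => by simp [hx z])
    (fun {x y} hy z => by
      rw [hB.mul_left]
      exact squareForm_eq_zero B (.inr (LinearMap.ext hy)) _)
    (fun {x y} hx z => by
      rw [hB.mul_left]
      exact squareForm_eq_zero B (.inl (LinearMap.ext hx)) _)

lemma mem_radical {m n : ℕ} {B : LinearMap.BilinForm Kq (FPrime m n)} (hB : IsLusztigForm B)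
    (x : FPrime m n) : x ∈ radical hB ↔ ∀ y, B x y = 0 := by
  rw [radical, TwoSidedIdeal.mem_mk']
  rfl

/-- The algebra `f = f' / 𝓘`, where `𝓘` is the radical of the form. -/
abbrev FAlg {m n : ℕ} {B : LinearMap.BilinForm Kq (FPrime m n)} (hB : IsLusztigForm B) : Type :=
  (radical hB).ringCon.Quotient

/-- The quotient map `f' → f`. -/
def toFAlg {m n : ℕ} {B : LinearMap.BilinForm Kq (FPrime m n)} (hB : IsLusztigForm B) :
    FPrime m n →ₐ[Kq] FAlg hB :=
  (radical hB).ringCon.mkₐ Kq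

/-! ### Positive roots, root vectors and PBW monomials -/

/-- The positive root `α_i + ⋯ + α_j`, for `i ≤ j` in `I`, as the pair `(i, j)`. The order is
lexicographic:
`α_1 < α_1 + α_2 < ⋯ < α_1 + ⋯ + α_{m+n-1} < α_2 < α_2 + α_3 < ⋯ < α_{m+n-1}`. -/
abbrev PosRoot (m n : ℕ) : Type :=
  {α : Idx m n ×ₗ Idx m n // (ofLex α).1 ≤ (ofLex α).2}

/-- The element `i + (i+1) + ⋯ + j` of `ℕ[I]`. -/
def segment (m n i j : ℕ) : Idx m n → ℕ := fun k => if i ≤ k ∧ (k : ℕ) ≤ j then 1 else 0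

/-- The parity `p(α_i + ⋯ + α_j) = p(α_i) + ⋯ + p(α_j)` of a positive root. -/
def PosRoot.parity {m n : ℕ} (α : PosRoot m n) : ZMod 2 :=
  SuperPBW.parity (segment m n (ofLex α.1).1 (ofLex α.1).2)

/-- The generator with the natural number `k` as index (`0` if `k ∉ I`, which does not occur in
the root vectors of positive roots). -/
def gen (m n k : ℕ) : FPrime m n :=
  if h : k ∈ Finset.Icc 1 (m + n - 1) then θ ⟨k, h⟩ else 0

/-- The root vector of `α_i + ⋯ + α_{i+d}`: it is `θ_i` for `d = 0`, and for
`α = α' + α_j`, `α' = α_i + ⋯ + α_{j-1}`, it is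
`θ_α = θ_{α'} θ_j - (-1)^{p(α') p(α_j)} q^{α' • α_j} θ_j θ_{α'}`. -/
def rootVectorAux (m n i : ℕ) : ℕ → FPrime m n
  | 0 => gen m n i
  | d + 1 =>
    rootVectorAux m n i d * gen m n (i + d + 1) -
      (sgn (parity (segment m n i (i + d)) * parity (segment m n (i + d + 1) (i + d + 1))) *
        q ^ bullet (segment m n i (i + d)) (segment m n (i + d + 1) (i + d + 1))) •
      (gen m n (i + d + 1) * rootVectorAux m n i d)

/-- The root vector `θ_α` of a positive root. -/
def rootVector {m n : ℕ} (α : PosRoot m n) : FPrime m n :=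
  rootVectorAux m n (ofLex α.1).1 ((ofLex α.1).2 - (ofLex α.1).1 : ℕ)

/-- The exponents `(n_α)` with `n_α ∈ ℕ`, and `n_α ∈ {0, 1}` if `α` is odd. -/
abbrev PBWExponent (m n : ℕ) : Type :=
  {e : PosRoot m n → ℕ // ∀ α, α.parity = 1 → e α ≤ 1}

/-- The product of the `θ_α^{n_α}`, arranged from left to right in increasing order of `α`. -/
def pbwMonomial {m n : ℕ} (e : PosRoot m n → ℕ) : FPrime m n :=
  (((Finset.univ : Finset (PosRoot m n)).sort (· ≤ ·)).map fun α => rootVector α ^ e α).prod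

/-! ### The super Serre relations -/

/-- The super Serre relators. -/
inductive SerreRelator (m n : ℕ) : FPrime m n → Prop
  | quartic (a b c : Idx m n) (ha : (a : ℕ) + 1 = m) (hb : (b : ℕ) = m) (hc : (c : ℕ) = m + 1) :
      SerreRelator m n
        ((q + q⁻¹) • (θ b * θ a * θ c * θ b) - θ a * θ b * θ c * θ b - θ b * θ a * θ b * θ c
          - θ b * θ c * θ b * θ a - θ c * θ b * θ a * θ b)
  | square (b : Idx m n) (hb : (b : ℕ) = m) : SerreRelator m n (θ b ^ 2)
  | comm (i j : Idx m n) (hij : (i : ℕ) + 1 < j ∨ (j : ℕ) + 1 < i) :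
      SerreRelator m n (θ i * θ j - θ j * θ i)
  | cubic (i j : Idx m n) (hi : (i : ℕ) ≠ m) (hij : (i : ℕ) + 1 = j ∨ (j : ℕ) + 1 = i) :
      SerreRelator m n ((q + q⁻¹) • (θ i * θ j * θ i) - θ i ^ 2 * θ j - θ j * θ i ^ 2)

/-- The two-sided ideal `𝓙` of `f'` generated by the super Serre relators. -/
def serreIdeal (m n : ℕ) : TwoSidedIdeal (FPrime m n) :=
  TwoSidedIdeal.span {x | SerreRelator m n x}

end SuperPBW
end

/-!
The form is built from the skew derivations `D_i` of `f'`: up to the scalar `(θ_i, θ_i)`, the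
operator `D_i` is adjoint to left multiplication by `θ_i`, and it is compatible with `Δ`. Hence an
element of nonzero weight lies in `𝓘` as soon as all `D_i` send it into `𝓘`, and the Serre relators
are checked one after the other in this way, which gives `𝓙 ⊆ 𝓘`.

In every algebra in which the Serre relations hold, a root vector can be moved past any smaller one
at the cost of a scalar and of products of later root vectors, and the odd root vectors have square
zero. So the ordered monomials span `f'` modulo `𝓙`.

On the other hand the comultiplication of a root vector is triangular with respect to the order:
apart from `θ_α ⊗ 1` and `1 ⊗ θ_α`, its first tensor factors have weights against which nothing
built from the smallest root occurring can pair. Therefore the ordered monomials are pairwise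
orthogonal, and a norm is a product of norms of root vectors and of geometric sums, which do not
vanish. So the span of the monomials meets `𝓘` in `0`, while together with `𝓙 ⊆ 𝓘` it spans `f'`:
the two ideals agree and the monomials form a basis of the quotient.
-/

noncomputable section

namespace SuperPBW

lemma ringCon_mk_eq_zero_iff {R A : Type*} [CommSemiring R] [Ring A] [Algebra R A]
    (I : TwoSidedIdeal A) {x : A} : I.ringCon.mkₐ R x = 0 ↔ x ∈ I := by
  rw [← map_zero (I.ringCon.mkₐ R), ← sub_zero x, ← TwoSidedIdeal.rel_iff, sub_zero]
  exact Quotient.eq''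

lemma disjoint_span_ker_of_iIsOrtho {K V ι : Type*} [Field K] [AddCommGroup V] [Module K V]
    {B : LinearMap.BilinForm K V} {v : ι → V} (hv : B.iIsOrtho v) (hne : ∀ i, B (v i) (v i) ≠ 0) :
    Disjoint (Submodule.span K (Set.range v)) (LinearMap.ker B) := by
  rw [Submodule.disjoint_def]
  intro x hx hBx
  obtain ⟨c, rfl⟩ := Finsupp.mem_span_range_iff_exists_finsupp.1 hx
  suffices c = 0 by simp [this]
  ext i
  have hci : B (c.sum fun j r => r • v j) (v i) = c i * B (v i) (v i) := by
    rw [Finsupp.sum, LinearMap.BilinForm.sum_left, Finset.sum_eq_single i]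
    · rw [LinearMap.BilinForm.smul_left]
    · intro j _ hj
      rw [LinearMap.BilinForm.smul_left, LinearMap.BilinForm.iIsOrtho_def.1 hv j i hj, mul_zero]
    · intro hi
      rw [Finsupp.notMem_support_iff.1 hi, zero_smul, LinearMap.BilinForm.zero_left]
  rw [LinearMap.mem_ker.1 hBx, LinearMap.zero_apply] at hci
  exact (mul_eq_zero.1 hci.symm).resolve_right (hne i)

/-! ### Commutation up to scalars -/

section QCommute

/-- The elements `x` and `y` commute up to the scalar `ξ`: `x y = ξ y x`. -/
def QCommute {R A : Type*} [CommSemiring R] [Semiring A] [Algebra R A] (ξ : R) (x y : A) : Prop :=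
  x * y = ξ • (y * x)

/-- The `c`-commutator `x y - c y x`. -/
def qBracket {R A : Type*} [CommRing R] [Ring A] [Algebra R A] (c : R) (x y : A) : A :=
  x * y - c • (y * x)

section CommSemiring

variable {R A : Type*} [CommSemiring R] [Semiring A] [Algebra R A] {ξ η : R} {x y z : A}

lemma qCommute_one_iff : QCommute (1 : R) x y ↔ x * y = y * x := by
  rw [QCommute, one_smul]

lemma QCommute.symm (h : QCommute ξ x y) (hη : η * ξ = 1) : QCommute η y x := by
  rw [QCommute, h, smul_smul, hη, one_smul]

lemma QCommute.mul_right (hy : QCommute ξ x y) (hz : QCommute η x z) :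
    QCommute (ξ * η) x (y * z) := by
  unfold QCommute at *
  rw [← mul_assoc, hy, smul_mul_assoc, mul_assoc, hz, mul_smul_comm, smul_smul, mul_assoc]

lemma QCommute.mul_left (hx : QCommute ξ x z) (hy : QCommute η y z) :
    QCommute (ξ * η) (x * y) z := by
  unfold QCommute at *
  rw [mul_assoc, hy, mul_smul_comm, ← mul_assoc, hx, smul_mul_assoc, smul_smul, mul_assoc,
    mul_comm η]

end CommSemiring

section CommRing

variable {R A : Type*} [CommRing R] [Ring A] [Algebra R A] {ξ η : R} {x y z : A}

lemma QCommute.qBracket_right (hy : QCommute ξ x y) (hz : QCommute η x z) (c : R) :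
    QCommute (ξ * η) x (qBracket c y z) := by
  have hyz := hy.mul_right hz
  have hzy := hz.mul_right hy
  unfold QCommute qBracket at *
  rw [mul_sub, mul_smul_comm, hyz, hzy, sub_mul, smul_sub, smul_mul_assoc, smul_comm c,
    mul_comm η]

lemma QCommute.qBracket_left (hx : QCommute ξ x z) (hy : QCommute η y z) (c : R) :
    QCommute (ξ * η) (qBracket c x y) z := by
  have hxy := hx.mul_left hy
  have hyx := hy.mul_left hx
  unfold QCommute qBracket at *
  rw [sub_mul, smul_mul_assoc, hxy, hyx, mul_sub, smul_sub, mul_smul_comm, smul_comm c,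
    mul_comm η]

lemma map_qBracket {B : Type*} [Ring B] [Algebra R B] (φ : A →ₐ[R] B) (c : R) (x y : A) :
    φ (qBracket c x y) = qBracket c (φ x) (φ y) := by
  simp only [qBracket, map_sub, map_smul, map_mul]

lemma qBracket_add_left (c : R) (x y z : A) :
    qBracket c (x + y) z = qBracket c x z + qBracket c y z := by
  simp only [qBracket, add_mul, mul_add, smul_add]
  abel

lemma qBracket_eq_zero_iff {c : R} : qBracket c x y = 0 ↔ QCommute c x y := sub_eq_zero

lemma qBracket_assoc (h : x * z = z * x) (y : A) (c d : R) :
    qBracket d (qBracket c x y) z = qBracket c x (qBracket d y z) := by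
  have h' (w : A) : x * (z * w) = z * (x * w) := by rw [← mul_assoc, h, mul_assoc]
  simp only [qBracket, mul_sub, sub_mul, mul_smul_comm, smul_mul_assoc, mul_assoc, smul_sub, h, h',
    smul_smul, mul_comm d c]
  abel

lemma qCommute_qBracket_of_mul_self_right (hy : y * y = 0) (x : A) (c : R) :
    QCommute (-c) (qBracket c x y) y := by
  have hy' (w : A) : y * (y * w) = 0 := by rw [← mul_assoc, hy, zero_mul]
  simp [QCommute, qBracket, mul_sub, sub_mul, mul_assoc, hy, hy']

lemma qCommute_qBracket_of_mul_self_left (hx : x * x = 0) (y : A) (c : R) :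
    QCommute (-c) x (qBracket c x y) := by
  have hx' (w : A) : x * (x * w) = 0 := by rw [← mul_assoc, hx, zero_mul]
  simp [QCommute, qBracket, mul_sub, sub_mul, mul_assoc, hx, hx']

lemma smul_qBracket_mul_self {c : R} (hx : QCommute ξ x (qBracket c x y))
    (hy : QCommute η (qBracket c x y) y) :
    ξ • (qBracket c x y * qBracket c x y) = η • (qBracket c x y * qBracket c x y) := by
  set w := qBracket c x y with hw
  have left : w * w = x * y * w - (c * ξ) • (y * w * x) := by
    rw [mul_smul, mul_assoc y, ← mul_smul_comm ξ, ← hx, ← mul_assoc, ← smul_mul_assoc, ← sub_mul]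
    rfl
  have right : ξ • (w * w) = η • (x * y * w) - (c * ξ * η) • (y * w * x) := by
    calc ξ • (w * w) = (ξ • (w * x)) * y - (c * ξ) • (w * y * x) := by
          nth_rw 2 [hw]
          rw [qBracket, mul_sub, smul_sub, mul_smul_comm, smul_smul, mul_comm ξ, smul_mul_assoc,
            mul_assoc, mul_assoc]
      _ = η • (x * y * w) - (c * ξ * η) • (y * w * x) := by
          rw [← hx, mul_assoc x, hy, mul_smul_comm, ← mul_assoc x, smul_mul_assoc, smul_smul]
  rw [right, left, smul_sub, smul_smul, mul_comm η]

end CommRing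

section Field

variable {K A : Type*} [Field K] [Ring A] [Algebra K A] {q c : K} {x y z : A}

lemma qBracket_mul_self_eq_zero {ξ η : K} (hx : QCommute ξ x (qBracket c x y))
    (hy : QCommute η (qBracket c x y) y) (hξη : ξ ≠ η) :
    qBracket c x y * qBracket c x y = 0 := by
  have h := sub_eq_zero.2 (smul_qBracket_mul_self hx hy)
  rw [← sub_smul] at h
  exact (smul_eq_zero.1 h).resolve_left (sub_ne_zero.2 hξη)

/-- The cubic Serre relation `(q + q⁻¹) x y x = x² y + y x²`. -/
def CubicRel (q : K) (x y : A) : Prop :=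
  (q + q⁻¹) • (x * y * x) = x ^ 2 * y + y * x ^ 2

/-- The quartic Serre relation between an odd element `y` and its neighbours `x` and `z`. -/
def QuarticRel (q : K) (x y z : A) : Prop :=
  (q + q⁻¹) • (y * x * z * y) =
    x * y * z * y + y * x * y * z + y * z * y * x + z * y * x * y

lemma CubicRel.qBracket_left (h : CubicRel q x y) (hz : z * x = x * z) (c : K) :
    CubicRel q x (qBracket c z y) := by
  have hzx (w : A) : z * (x * w) = x * (z * w) := by rw [← mul_assoc, hz, mul_assoc]
  have hl := congrArg (z * ·) h
  have hr := congrArg (· * z) h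
  simp only [CubicRel, qBracket, pow_two, mul_add, add_mul, mul_sub, sub_mul, mul_smul_comm,
    smul_mul_assoc, mul_assoc, hz, hzx] at hl hr ⊢
  rw [smul_sub, hl, smul_comm, hr]
  module

lemma cubicRel_iff_qCommute_left (hc : c ≠ 0) (hqc : q + q⁻¹ = c + c⁻¹) :
    CubicRel q x y ↔ QCommute c⁻¹ x (qBracket c x y) := by
  have key : x * qBracket c x y - c⁻¹ • (qBracket c x y * x) =
      x ^ 2 * y + y * x ^ 2 - (q + q⁻¹) • (x * y * x) := by
    simp only [qBracket, hqc, pow_two, mul_sub, sub_mul, mul_smul_comm, smul_mul_assoc, mul_assoc,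
      smul_sub, smul_smul, inv_mul_cancel₀ hc]
    module
  rw [CubicRel, QCommute, ← sub_eq_zero (a := x * _), key, sub_eq_zero, eq_comm]

lemma cubicRel_iff_qCommute_right (hc : c ≠ 0) (hqc : q + q⁻¹ = c + c⁻¹) :
    CubicRel q x y ↔ QCommute c⁻¹ (qBracket c y x) x := by
  have key : qBracket c y x * x - c⁻¹ • (x * qBracket c y x) =
      x ^ 2 * y + y * x ^ 2 - (q + q⁻¹) • (x * y * x) := by
    simp only [qBracket, hqc, pow_two, mul_sub, sub_mul, mul_smul_comm, smul_mul_assoc, mul_assoc,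
      smul_sub, smul_smul, inv_mul_cancel₀ hc]
    module
  rw [CubicRel, QCommute, ← sub_eq_zero (a := qBracket c y x * x), key, sub_eq_zero, eq_comm]

lemma quarticRel_iff_qCommute (hq : q ≠ 0) (hxz : x * z = z * x) (hy : y * y = 0) :
    QuarticRel q x y z ↔ QCommute (-1 : K) y (qBracket q (qBracket q⁻¹ x y) z) := by
  have hy' (w : A) : y * (y * w) = 0 := by rw [← mul_assoc, hy, zero_mul]
  have key : y * qBracket q (qBracket q⁻¹ x y) z -
      (-1 : K) • (qBracket q (qBracket q⁻¹ x y) z * y) =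
      x * y * z * y + y * x * y * z + y * z * y * x + z * y * x * y -
        (q + q⁻¹) • (y * x * z * y) := by
    simp only [qBracket, mul_sub, sub_mul, mul_smul_comm, smul_mul_assoc, mul_assoc, smul_sub,
      smul_smul, hxz, hy, hy', mul_zero, smul_zero, mul_inv_cancel₀ hq]
    module
  rw [QuarticRel, QCommute, ← sub_eq_zero (a := y * _), key, sub_eq_zero, eq_comm]

/-- Writing `u = [x, y]`, `v = [y, z]` and `w = [u, z] = [x, v]`, the two expressions for `w` give
`y w = c² w y + c (u v - v u)` and `y w = c⁻² w y - c⁻¹ (u v - v u)`. -/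
lemma commute_qBracket_qBracket (hc : c ≠ 0) (hc' : c + c⁻¹ ≠ 0) (hxz : x * z = z * x)
    (hu : QCommute c⁻¹ (qBracket c x y) y) (hv : QCommute c⁻¹ y (qBracket c y z)) :
    y * qBracket c (qBracket c x y) z = qBracket c (qBracket c x y) z * y := by
  set w := qBracket c (qBracket c x y) z with hw
  have hw' : w = qBracket c x (qBracket c y z) := qBracket_assoc hxz y c c
  set u := qBracket c x y with hu_def
  set v := qBracket c y z with hv_def
  have hyu : y * u = c • (u * y) := hu.symm (mul_inv_cancel₀ hc)
  have hyz : y * z = v + c • (z * y) := by rw [hv_def, qBracket, sub_add_cancel]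
  have hyx : y * x = c⁻¹ • (x * y - u) := by
    rw [hu_def, qBracket, sub_sub_cancel, inv_smul_smul₀ hc]
  have expand_left : y * w = c ^ 2 • (w * y) + c • (u * v - v * u) := by
    calc y * w = y * u * z - c • (y * z * u) := by
          rw [hw, qBracket, mul_sub, mul_smul_comm, mul_assoc, mul_assoc]
      _ = c • (u * (y * z)) - c • (y * z * u) := by rw [hyu, smul_mul_assoc, mul_assoc]
      _ = c • (u * v - v * u) + c ^ 2 • (u * z * y - z * (y * u)) := by
          rw [hyz, mul_add, add_mul, mul_smul_comm, smul_mul_assoc, mul_assoc, mul_assoc]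
          module
      _ = _ := by
          rw [hyu, mul_smul_comm, ← mul_assoc, ← smul_mul_assoc, ← sub_mul, add_comm]
          rfl
  have expand_right : y * w = c⁻¹ ^ 2 • (w * y) - c⁻¹ • (u * v - v * u) := by
    calc y * w = y * x * v - c • (y * v * x) := by
          rw [hw', qBracket, mul_sub, mul_smul_comm, mul_assoc, mul_assoc]
      _ = c⁻¹ • (x * (y * v)) - c⁻¹ • (u * v) - v * (y * x) := by
          rw [hyx, smul_mul_assoc, sub_mul, smul_sub, mul_assoc, hv, smul_mul_assoc,
            smul_inv_smul₀ hc, mul_assoc, hyx]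
      _ = c⁻¹ ^ 2 • (x * v * y - c • (v * x * y)) - c⁻¹ • (u * v - v * u) := by
          rw [hv, hyx, mul_smul_comm, mul_smul_comm, mul_sub, smul_sub (c⁻¹ ^ 2), smul_smul _ c,
            pow_two, mul_assoc c⁻¹, inv_mul_cancel₀ hc, mul_one, ← mul_assoc, ← mul_assoc]
          module
      _ = _ := by rw [← smul_mul_assoc, ← sub_mul, hw', qBracket]
  have hsmul : (c + c⁻¹) • (y * w) = (c + c⁻¹) • (w * y) := by
    rw [add_smul]
    nth_rw 1 [expand_right]
    rw [expand_left, smul_sub, smul_add, smul_smul, smul_smul, smul_smul, smul_smul,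
      mul_inv_cancel₀ hc, inv_mul_cancel₀ hc, pow_two, pow_two, ← mul_assoc, ← mul_assoc,
      mul_inv_cancel₀ hc, inv_mul_cancel₀ hc]
    module
  exact smul_right_injective A hc' hsmul

end Field

end QCommute

/-! ### Ordered monomials in an algebra satisfying the Serre relations -/

section OrderedMonomials

variable {R A : Type*} [CommSemiring R] [Semiring A] [Algebra R A]

/-- The elements `u` of a subalgebra `U` which can be moved to the right of `b` modulo `U`:
`u b ∈ b U + U`. -/
def movable (U : Subalgebra R A) (b : A) : Subalgebra R A where
  carrier := {u | u ∈ U ∧ ∃ x ∈ U, ∃ y ∈ U, u * b = b * x + y}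
  mul_mem' := by
    rintro u v ⟨hu, x, hx, y, hy, h⟩ ⟨hv, x', hx', y', hy', h'⟩
    refine ⟨mul_mem hu hv, x * x', mul_mem hx hx', y * x' + u * y',
      add_mem (mul_mem hy hx') (mul_mem hu hy'), ?_⟩
    rw [mul_assoc, h', mul_add, ← mul_assoc, h, add_mul, mul_assoc, add_assoc]
  add_mem' := by
    rintro u v ⟨hu, x, hx, y, hy, h⟩ ⟨hv, x', hx', y', hy', h'⟩
    refine ⟨add_mem hu hv, x + x', add_mem hx hx', y + y', add_mem hy hy', ?_⟩
    rw [add_mul, h, h', mul_add, add_add_add_comm]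
  algebraMap_mem' r := ⟨U.algebraMap_mem r, _, U.algebraMap_mem r, 0, zero_mem U, by
    rw [add_zero, Algebra.commutes]⟩

lemma QCommute.mem_movable {U : Subalgebra R A} {b u : A} {ξ : R} (h : QCommute ξ u b)
    (hu : u ∈ U) : u ∈ movable U b :=
  ⟨hu, ξ • u, U.smul_mem hu ξ, 0, zero_mem U, by rw [h, mul_smul_comm, add_zero]⟩

lemma adjoin_le_of_mul_mem {s : Set A} {W : Submodule R A} (one_mem : (1 : A) ∈ W)
    (mul_mem : ∀ w ∈ W, ∀ x ∈ s, w * x ∈ W) : (Algebra.adjoin R s).toSubmodule ≤ W := by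
  intro u hu
  suffices ∀ w ∈ W, w * u ∈ W by simpa only [one_mul] using this 1 one_mem
  induction hu using Algebra.adjoin_induction with
  | mem x hx => exact fun w hw => mul_mem w hw x hx
  | algebraMap r =>
    intro w hw
    rw [← Algebra.commutes, ← Algebra.smul_def]
    exact W.smul_mem r hw
  | add x y _ _ hx hy => intro w hw; rw [mul_add]; exact add_mem (hx w hw) (hy w hw)
  | mul x y _ _ hx hy => intro w hw; rw [← mul_assoc]; exact hy _ (hx w hw)

lemma adjoin_insert_le_span_pow_mul {s : Set A} {b : A}
    (h : s ⊆ movable (Algebra.adjoin R s) b) :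
    (Algebra.adjoin R (insert b s)).toSubmodule ≤
      Submodule.span R {x | ∃ k : ℕ, ∃ u ∈ Algebra.adjoin R s, b ^ k * u = x} := by
  refine adjoin_le_of_mul_mem (Submodule.subset_span ⟨0, 1, one_mem _, by simp⟩) ?_
  intro w hw x hx
  induction hw using Submodule.span_induction with
  | zero => simp
  | add w w' _ _ hw hw' => rw [add_mul]; exact add_mem hw hw'
  | smul r w _ hw => rw [smul_mul_assoc]; exact Submodule.smul_mem _ _ hw
  | mem w hw =>
    obtain ⟨k, u, hu, rfl⟩ := hw
    rcases hx with rfl | hx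
    · obtain ⟨-, v, hv, v', hv', huv⟩ := Algebra.adjoin_le h hu
      rw [mul_assoc, huv, mul_add, ← mul_assoc, ← pow_succ]
      exact add_mem (Submodule.subset_span ⟨_, _, hv, rfl⟩) (Submodule.subset_span ⟨_, _, hv', rfl⟩)
    · rw [mul_assoc]
      exact Submodule.subset_span ⟨_, _, mul_mem hu (Algebra.subset_adjoin hx), rfl⟩

lemma pow_mul_mem_span_prod_map_pow {ι : Type*} {f : ι → A} {β : ι} {L : List ι} (hβ : β ∉ L)
    (k : ℕ) {u : A}
    (hu : u ∈ Submodule.span R (Set.range fun e : ι → ℕ => (L.map fun α => f α ^ e α).prod)) :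
    f β ^ k * u ∈
      Submodule.span R (Set.range fun e : ι → ℕ => ((β :: L).map fun α => f α ^ e α).prod) := by
  classical
  induction hu using Submodule.span_induction with
  | zero => simp
  | add x y _ _ hx hy => rw [mul_add]; exact add_mem hx hy
  | smul r x _ hx => rw [mul_smul_comm]; exact Submodule.smul_mem _ _ hx
  | mem x hx =>
    obtain ⟨e, rfl⟩ := hx
    have hL : (L.map fun α => f α ^ Function.update e β k α) = L.map fun α => f α ^ e α :=
      List.map_congr_left fun α hα => by
        rw [Function.update_of_ne (ne_of_mem_of_not_mem hα hβ)]
    refine Submodule.subset_span ⟨Function.update e β k, ?_⟩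
    simp only [List.map_cons, List.prod_cons, Function.update_self, hL]

lemma adjoin_le_span_prod_map_pow {ι : Type*} [Preorder ι] {f : ι → A} {L : List ι}
    (hL : L.Pairwise (· < ·))
    (hf : ∀ β ∈ L, ∀ γ ∈ L, β < γ →
      f γ ∈ movable (Algebra.adjoin R (f '' {δ ∈ L | β < δ})) (f β)) :
    (Algebra.adjoin R (f '' {γ | γ ∈ L})).toSubmodule ≤
      Submodule.span R (Set.range fun e : ι → ℕ => (L.map fun α => f α ^ e α).prod) := by
  induction L with
  | nil =>
    refine adjoin_le_of_mul_mem (Submodule.subset_span ⟨0, by simp⟩) ?_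
    rintro w - x ⟨γ, hγ, -⟩
    simp at hγ
  | cons β L ih =>
    rw [List.pairwise_cons] at hL
    have above_head : {δ | δ ∈ β :: L ∧ β < δ} = {γ | γ ∈ L} := by
      ext δ
      simp only [List.mem_cons, Set.mem_ofPred_eq]
      exact ⟨fun h => h.1.resolve_left h.2.ne', fun h => ⟨.inr h, hL.1 δ h⟩⟩
    have above_tail (γ) (hγ : γ ∈ L) : {δ | δ ∈ β :: L ∧ γ < δ} = {δ | δ ∈ L ∧ γ < δ} := by
      ext δ
      simp only [List.mem_cons, Set.mem_ofPred_eq]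
      refine ⟨fun h => ⟨h.1.resolve_left ?_, h.2⟩, fun h => ⟨.inr h.1, h.2⟩⟩
      exact ((hL.1 γ hγ).trans h.2).ne'
    have ih := ih hL.2 fun γ hγ δ hδ h => by
      rw [← above_tail γ hγ]
      exact hf γ (List.mem_cons_of_mem _ hγ) δ (List.mem_cons_of_mem _ hδ) h
    have image_cons : f '' {γ | γ ∈ β :: L} = insert (f β) (f '' {γ | γ ∈ L}) := by
      rw [← Set.image_insert_eq]
      congr 1
      ext δ
      simp
    rw [image_cons]
    refine (adjoin_insert_le_span_pow_mul ?_).trans (Submodule.span_le.2 ?_)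
    · rintro _ ⟨γ, hγ, rfl⟩
      rw [← above_head]
      exact hf β List.mem_cons_self γ (List.mem_cons_of_mem _ hγ) (hL.1 γ hγ)
    · rintro _ ⟨k, u, hu, rfl⟩
      exact pow_mul_mem_span_prod_map_pow (fun h => (hL.1 β h).false) k (ih hu)

end OrderedMonomials

section SerreSystem

variable {K A : Type*} [Field K] [Ring A] [Algebra K A]

/-- A family of elements satisfying the super Serre relations, where `g m` is the odd one. -/
structure SerreSystem (m : ℕ) (q : K) (g : ℕ → A) : Prop where
  q_ne_zero : q ≠ 0
  q_add_inv_ne_zero : q + q⁻¹ ≠ 0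
  comm : ∀ i j, i + 1 < j → g i * g j = g j * g i
  square : g m * g m = 0
  cubic : ∀ i j, i ≠ m → i + 1 = j ∨ j + 1 = i → CubicRel q (g i) (g j)
  quartic : ∀ k, k + 1 = m → QuarticRel q (g k) (g m) (g (m + 1))

/-- The coefficient `q ^ ((j - 1) • j)` of the bracket which attaches `g j` to a root vector. -/
def braidCoeff (m : ℕ) (q : K) (j : ℕ) : K := if j ≤ m then q⁻¹ else q

/-- The root vector of `α_s + ⋯ + α_j` built from the family `g` (junk value `g s` if `j < s`). -/
def rootVec (m : ℕ) (q : K) (g : ℕ → A) (s : ℕ) : ℕ → A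
  | 0 => g s
  | j + 1 =>
    if s ≤ j then qBracket (braidCoeff m q (j + 1)) (rootVec m q g s j) (g (j + 1)) else g s

variable {m : ℕ} {q : K} {g : ℕ → A} {s j : ℕ}

lemma rootVec_self (s : ℕ) : rootVec m q g s s = g s := by
  cases s with
  | zero => rfl
  | succ s => exact if_neg s.not_succ_le_self

lemma rootVec_succ (h : s ≤ j) : rootVec m q g s (j + 1) =
    qBracket (braidCoeff m q (j + 1)) (rootVec m q g s j) (g (j + 1)) :=
  if_pos h

lemma q_add_inv_eq (m : ℕ) (q : K) (j : ℕ) :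
    q + q⁻¹ = braidCoeff m q j + (braidCoeff m q j)⁻¹ := by
  unfold braidCoeff
  split_ifs
  · rw [inv_inv, add_comm]
  · rfl

lemma braidCoeff_ne_zero (hq : q ≠ 0) (j : ℕ) : braidCoeff m q j ≠ 0 := by
  unfold braidCoeff
  split_ifs
  · exact inv_ne_zero hq
  · exact hq

namespace SerreSystem

lemma qCommute_far {i j : ℕ} (H : SerreSystem m q g) (h : i + 1 < j) :
    QCommute (1 : K) (g i) (g j) :=
  qCommute_one_iff.2 (H.comm i j h)

lemma rootVec_far {k : ℕ} (H : SerreSystem m q g) (hs : s ≤ j) (hk : j + 1 < k) :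
    QCommute (1 : K) (rootVec m q g s j) (g k) := by
  induction j, hs using Nat.le_induction with
  | base => rw [rootVec_self]; exact H.qCommute_far hk
  | succ j hj ih =>
    rw [rootVec_succ hj]
    simpa only [one_mul] using (ih (by omega)).qBracket_left (H.qCommute_far hk) _

lemma rootVec_eq_qBracket {k : ℕ} (H : SerreSystem m q g) (hs : s ≤ k) (hk : k < j) :
    rootVec m q g s j =
      qBracket (braidCoeff m q (k + 1)) (rootVec m q g s k) (rootVec m q g (k + 1) j) := by
  induction j, Nat.succ_le_of_lt hk using Nat.le_induction with
  | base => rw [Nat.succ_eq_add_one, rootVec_self, rootVec_succ hs]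
  | succ j hj ih =>
    have hfar := qCommute_one_iff.1 (H.rootVec_far hs (show k + 1 < j + 1 by omega))
    rw [rootVec_succ (by omega), rootVec_succ (by omega), ih (by omega), qBracket_assoc hfar]

lemma rootVec_cubic {k : ℕ} (H : SerreSystem m q g) (hs : s ≤ k) (hk : k + 1 ≠ m) :
    CubicRel q (g (k + 1)) (rootVec m q g s k) := by
  rcases hs.eq_or_lt with rfl | hs
  · rw [rootVec_self]
    exact H.cubic _ _ hk (.inr rfl)
  · obtain ⟨j, rfl⟩ := Nat.exists_eq_add_of_lt hs
    rw [rootVec_succ (by omega)]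
    exact (H.cubic _ _ hk (.inr rfl)).qBracket_left
      (qCommute_one_iff.1 (H.rootVec_far (by omega) (by omega))) _

lemma rootVec_last {k : ℕ} (H : SerreSystem m q g) (hs : s ≤ k) :
    ∃ ξ : K, ξ ≠ 0 ∧ QCommute ξ (rootVec m q g s (k + 1)) (g (k + 1)) := by
  rw [rootVec_succ hs]
  have hc := braidCoeff_ne_zero (m := m) H.q_ne_zero (k + 1)
  by_cases hk : k + 1 = m
  · exact ⟨_, neg_ne_zero.2 hc, qCommute_qBracket_of_mul_self_right (hk ▸ H.square) _ _⟩
  · exact ⟨_, inv_ne_zero hc,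
      (cubicRel_iff_qCommute_right hc (q_add_inv_eq m q _)).1 (H.rootVec_cubic hs hk)⟩

lemma rootVec_middle_triple (H : SerreSystem m q g) (k : ℕ) :
    QCommute (if k + 1 = m then -1 else 1 : K) (g (k + 1)) (rootVec m q g k (k + 2)) := by
  rw [rootVec_succ (by omega), rootVec_succ le_rfl, rootVec_self]
  have hcomm := H.comm k (k + 2) (by omega)
  split_ifs with hk
  · have hc : braidCoeff m q (k + 1) = q⁻¹ := if_pos (by omega)
    have hc' : braidCoeff m q (k + 1 + 1) = q := if_neg (by omega)
    rw [hc, hc']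
    refine (quarticRel_iff_qCommute H.q_ne_zero hcomm (hk ▸ H.square)).1 ?_
    simpa only [← hk] using H.quartic k hk
  · have hc : braidCoeff m q (k + 1 + 1) = braidCoeff m q (k + 1) := by
      unfold braidCoeff
      congr 1
      rw [eq_iff_iff]
      omega
    have hqc := q_add_inv_eq m q (k + 1)
    have hc0 := braidCoeff_ne_zero (m := m) H.q_ne_zero (k + 1)
    rw [hc, qCommute_one_iff]
    exact commute_qBracket_qBracket hc0 (hqc ▸ H.q_add_inv_ne_zero) hcomm
      ((cubicRel_iff_qCommute_right hc0 hqc).1 (H.cubic _ _ hk (.inr rfl)))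
      ((cubicRel_iff_qCommute_left hc0 hqc).1 (H.cubic _ _ hk (.inl rfl)))

lemma rootVec_middle {k : ℕ} (H : SerreSystem m q g) (hs : s < k) (hk : k < j) :
    QCommute (if k = m then -1 else 1 : K) (g k) (rootVec m q g s j) := by
  obtain ⟨k, rfl⟩ := Nat.exists_eq_add_of_lt (Nat.zero_lt_of_lt hs)
  simp only [zero_add] at *
  induction j, Nat.succ_le_of_lt hk using Nat.le_induction with
  | base =>
    rcases (Nat.lt_succ_iff.1 hs).eq_or_lt with rfl | hs
    · exact H.rootVec_middle_triple s
    · obtain ⟨l, rfl⟩ := Nat.exists_eq_add_of_lt hs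
      have hfar := (H.rootVec_far (s := s) (j := s + l) (k := s + l + 1 + 1) (by omega)
        (by omega)).symm (one_mul 1)
      rw [H.rootVec_eq_qBracket (k := s + l) (by omega) (by omega)]
      simpa only [one_mul] using hfar.qBracket_right (H.rootVec_middle_triple _) _
  | succ j hj ih =>
    rw [rootVec_succ (by omega)]
    simpa only [mul_one] using
      (ih (by omega)).qBracket_right (H.qCommute_far (show k + 1 + 1 < j + 1 by omega)) _

lemma rootVec_adjacent (H : SerreSystem m q g) (hs : s ≤ j) :
    ∃ ξ : K, ξ ≠ 0 ∧ (j < m → ξ = q) ∧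
      QCommute ξ (rootVec m q g s j) (rootVec m q g s (j + 1)) := by
  induction j, hs using Nat.le_induction with
  | base =>
    rw [rootVec_succ le_rfl, rootVec_self]
    have hc := braidCoeff_ne_zero (m := m) H.q_ne_zero (s + 1)
    by_cases hsm : s = m
    · exact ⟨_, neg_ne_zero.2 hc, fun h => absurd hsm h.ne,
        qCommute_qBracket_of_mul_self_left (hsm ▸ H.square) _ _⟩
    · refine ⟨_, inv_ne_zero hc, fun h => by rw [braidCoeff, if_pos (by omega), inv_inv],
        (cubicRel_iff_qCommute_left hc (q_add_inv_eq m q _)).1 (H.cubic s (s + 1) hsm (.inl rfl))⟩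
  | succ j hj ih =>
    obtain ⟨ξ, hξ, hξq, h⟩ := ih
    have hleft := h.qBracket_right (H.rootVec_far hj (show j + 1 < j + 2 by omega))
      (braidCoeff m q (j + 2))
    rw [mul_one, ← rootVec_succ (by omega)] at hleft
    have hmiddle := H.rootVec_middle (s := s) (k := j + 1) (j := j + 2) (by omega) (by omega)
    refine ⟨_, mul_ne_zero hξ ?_, fun hm => ?_, (rootVec_succ (m := m) (q := q) (g := g) hj) ▸
      hleft.qBracket_left hmiddle (braidCoeff m q (j + 1))⟩
    · split_ifs <;> simp
    · rw [hξq (by omega), if_neg (by omega), mul_one]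

lemma rootVec_row {l : ℕ} (H : SerreSystem m q g) (hs : s ≤ j) (hl : j < l) :
    ∃ ξ : K, ξ ≠ 0 ∧ QCommute ξ (rootVec m q g s j) (rootVec m q g s l) := by
  induction l, Nat.succ_le_of_lt hl using Nat.le_induction with
  | base =>
    obtain ⟨ξ, hξ, -, h⟩ := H.rootVec_adjacent hs
    exact ⟨ξ, hξ, h⟩
  | succ l hl ih =>
    obtain ⟨ξ, hξ, h⟩ := ih (by omega)
    rw [rootVec_succ (by omega)]
    exact ⟨_, mul_ne_zero hξ one_ne_zero, h.qBracket_right (H.rootVec_far hs (by omega)) _⟩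

lemma rootVec_mul_self (H : SerreSystem m q g) (hs : s ≤ m) (hj : m ≤ j) :
    rootVec m q g s j * rootVec m q g s j = 0 := by
  induction j, hj using Nat.le_induction with
  | base =>
    rcases hs.eq_or_lt with rfl | hs
    · rw [rootVec_self]; exact H.square
    · obtain ⟨k, rfl⟩ := Nat.exists_eq_add_of_lt hs
      obtain ⟨ξ, -, hξ, h⟩ := H.rootVec_adjacent (s := s) (j := s + k) (by omega)
      rw [hξ (by omega), rootVec_succ (by omega)] at h
      rw [rootVec_succ (by omega)]
      refine qBracket_mul_self_eq_zero h (qCommute_qBracket_of_mul_self_right H.square _ _) ?_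
      rw [braidCoeff, if_pos le_rfl, ne_eq, eq_neg_iff_add_eq_zero]
      exact H.q_add_inv_ne_zero
  | succ j hj ih =>
    rw [rootVec_succ (by omega)]
    refine qBracket_mul_self_eq_zero (qCommute_qBracket_of_mul_self_left ih _ _)
      ((cubicRel_iff_qCommute_right (braidCoeff_ne_zero H.q_ne_zero _) (q_add_inv_eq m q _)).1
        (H.rootVec_cubic (by omega) (by omega))) ?_
    rw [braidCoeff, if_neg (by omega), ne_eq, neg_eq_iff_add_eq_zero]
    exact H.q_add_inv_ne_zero

lemma gen_mem_movable {k : ℕ} (H : SerreSystem m q g) {U : Subalgebra K A} (hs : s ≤ j)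
    (hk : s < k) (hg : g k ∈ U) (hnext : k = j + 1 → rootVec m q g s (j + 1) ∈ U) :
    g k ∈ movable U (rootVec m q g s j) := by
  rcases lt_trichotomy k j with hkj | rfl | hjk
  · exact (H.rootVec_middle hk hkj).mem_movable hg
  · obtain ⟨i, rfl⟩ := Nat.exists_eq_add_of_lt hk
    obtain ⟨ξ, hξ, h⟩ := H.rootVec_last (s := s) (k := s + i) (by omega)
    exact (h.symm (inv_mul_cancel₀ hξ)).mem_movable hg
  rcases (Nat.succ_le_of_lt hjk).eq_or_lt with rfl | hjk
  · have hc := braidCoeff_ne_zero (m := m) H.q_ne_zero (j + 1)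
    refine ⟨hg, _, U.smul_mem hg (braidCoeff m q (j + 1))⁻¹, _,
      U.smul_mem (hnext rfl) (-(braidCoeff m q (j + 1))⁻¹), ?_⟩
    rw [rootVec_succ hs, qBracket, smul_sub, mul_smul_comm, smul_smul, neg_mul,
      inv_mul_cancel₀ hc, neg_smul, neg_smul, one_smul]
    abel
  · exact ((H.rootVec_far hs hjk).symm (one_mul 1)).mem_movable hg

lemma rootVec_mem_movable {i l : ℕ} (H : SerreSystem m q g) {U : Subalgebra K A} (hs : s ≤ j)
    (hi : s < i) (hil : i ≤ l) (hg : ∀ k, i ≤ k → k ≤ l → g k ∈ U)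
    (hnext : j + 1 ≤ l → rootVec m q g s (j + 1) ∈ U) :
    rootVec m q g i l ∈ movable U (rootVec m q g s j) := by
  have hgen (k : ℕ) (hik : i ≤ k) (hkl : k ≤ l) : g k ∈ movable U (rootVec m q g s j) :=
    H.gen_mem_movable hs (by omega) (hg k hik hkl) fun h => hnext (by omega)
  clear hg hnext
  induction l, hil using Nat.le_induction with
  | base =>
    rw [rootVec_self]
    exact hgen i le_rfl le_rfl
  | succ l hil ih =>
    have hl := hgen (l + 1) (by omega) le_rfl
    have ih := ih fun k hik hkl => hgen k hik (by omega)
    rw [rootVec_succ hil]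
    exact sub_mem (mul_mem ih hl) (Subalgebra.smul_mem _ (mul_mem hl ih) _)

end SerreSystem

end SerreSystem

/-! ### Skew derivations -/

variable {m n : ℕ}

lemma span_range_monomial :
    Submodule.span Kq (Set.range (monomial (m := m) (n := n))) = ⊤ := by
  rw [← (FreeAlgebra.basisFreeMonoid Kq (Idx m n)).span_eq,
    show ⇑(FreeAlgebra.basisFreeMonoid Kq (Idx m n)) = monomial from funext basisFreeMonoid_eq]

lemma linearMap_ext_monomial {M : Type*} [AddCommMonoid M] [Module Kq M]
    {f g : FPrime m n →ₗ[Kq] M} (h : ∀ w, f (monomial w) = g (monomial w)) : f = g :=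
  (FreeAlgebra.basisFreeMonoid Kq (Idx m n)).ext fun w => by
    simpa only [basisFreeMonoid_eq] using h w

lemma linearMap_ext_tens_monomial {M : Type*} [AddCommMonoid M] [Module Kq M]
    {f g : TwistedSquare m n →ₗ[Kq] M}
    (h : ∀ a b, f (tens (monomial a) (monomial b)) = g (tens (monomial a) (monomial b))) :
    f = g :=
  (pairBasis m n).ext fun w => by simpa only [pairBasis_eq] using h w.1 w.2

lemma monomial_of_mul (i : Idx m n) (w : FreeMonoid (Idx m n)) :
    monomial (FreeMonoid.of i * w) = θ i * monomial w := by
  rw [map_mul]; rfl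

@[elab_as_elim]
lemma theta_mul_induction {motive : FPrime m n → Prop} (one : motive 1)
    (theta_mul : ∀ i x, motive x → motive (θ i * x))
    (add : ∀ x y, motive x → motive y → motive (x + y))
    (smul : ∀ (r : Kq) x, motive x → motive (r • x)) (x : FPrime m n) : motive x := by
  have monomial_case (w) : motive (monomial w) := by
    induction w using FreeMonoid.inductionOn' with
    | one => rwa [map_one]
    | of_mul i w ih => rw [monomial_of_mul]; exact theta_mul _ _ ih
  have hx : x ∈ Submodule.span Kq (Set.range monomial) := span_range_monomial ▸ trivial
  induction hx using Submodule.span_induction with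
  | mem x hx => obtain ⟨w, rfl⟩ := hx; exact monomial_case w
  | zero => simpa only [zero_smul] using smul 0 1 one
  | add x y _ _ hx hy => exact add _ _ hx hy
  | smul r x _ hx => exact smul _ _ hx

/-- The weight `i ∈ ℕ[I]` of the generator `θ i`. -/
def simple (i : Idx m n) : Idx m n → ℕ := weight (FreeMonoid.of i)

lemma simple_apply (i j : Idx m n) : simple i j = if i = j then 1 else 0 := by
  simp [simple, weight, List.count_singleton, beq_iff_eq]

lemma exists_eq_simple_add {μ : Idx m n → ℕ} {i : Idx m n} (hi : μ i ≠ 0) :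
    ∃ ν, μ = simple i + ν := by
  refine ⟨μ - simple i, (add_tsub_cancel_of_le fun k => ?_).symm⟩
  rw [simple_apply]
  split_ifs with h
  · exact h ▸ Nat.one_le_iff_ne_zero.mpr hi
  · exact Nat.zero_le _

lemma weight_of_mul (i : Idx m n) (w : FreeMonoid (Idx m n)) :
    weight (FreeMonoid.of i * w) = simple i + weight w := weight_mul _ _

lemma monomial_mem_weightSpace (w : FreeMonoid (Idx m n)) :
    monomial w ∈ weightSpace (weight w) :=
  Submodule.subset_span ⟨w, rfl, rfl⟩

lemma one_mem_weightSpace : (1 : FPrime m n) ∈ weightSpace (0 : Idx m n → ℕ) := by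
  simpa only [weight_one, map_one] using monomial_mem_weightSpace (1 : FreeMonoid (Idx m n))

lemma theta_mem_weightSpace (i : Idx m n) : θ i ∈ weightSpace (simple i) :=
  monomial_mem_weightSpace (FreeMonoid.of i)

lemma mul_mem_weightSpace {μ ν : Idx m n → ℕ} {x y : FPrime m n} (hx : x ∈ weightSpace μ)
    (hy : y ∈ weightSpace ν) : x * y ∈ weightSpace (μ + ν) := by
  have hxy : x * y ∈ weightSpace μ * weightSpace ν := Submodule.mul_mem_mul hx hy
  rw [weightSpace, weightSpace, Submodule.span_mul_span] at hxy
  refine Submodule.span_mono ?_ hxy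
  rintro _ ⟨_, ⟨a, rfl, rfl⟩, _, ⟨b, rfl, rfl⟩, rfl⟩
  exact ⟨a * b, weight_mul a b, map_mul _ _ _⟩

lemma qBracket_mem_weightSpace {μ ν : Idx m n → ℕ} {x y : FPrime m n} (hx : x ∈ weightSpace μ)
    (hy : y ∈ weightSpace ν) (c : Kq) : qBracket c x y ∈ weightSpace (μ + ν) :=
  sub_mem (mul_mem_weightSpace hx hy)
    (Submodule.smul_mem _ _ (add_comm ν μ ▸ mul_mem_weightSpace hy hx))

@[elab_as_elim]
lemma weightSpace_induction {motive : ∀ μ (x : FPrime m n), x ∈ weightSpace μ → Prop}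
    (one : motive 0 1 one_mem_weightSpace)
    (theta_mul : ∀ i μ x hx, motive μ x hx →
      motive (simple i + μ) (θ i * x) (mul_mem_weightSpace (theta_mem_weightSpace i) hx))
    (zero : ∀ μ, motive μ 0 (zero_mem _))
    (add : ∀ μ x y hx hy, motive μ x hx → motive μ y hy → motive μ (x + y) (add_mem hx hy))
    (smul : ∀ (r : Kq) μ x hx, motive μ x hx → motive μ (r • x) (Submodule.smul_mem _ r hx))
    {μ : Idx m n → ℕ} {x : FPrime m n} (hx : x ∈ weightSpace μ) : motive μ x hx := by
  have monomial_case (w) : motive (weight w) (monomial w) (monomial_mem_weightSpace w) := by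
    induction w using FreeMonoid.inductionOn' with
    | one => simpa only [map_one, weight_one] using one
    | of_mul i w ih => simpa only [monomial_of_mul, weight_of_mul] using theta_mul _ _ _ _ ih
  induction hx using Submodule.span_induction with
  | mem x hx => obtain ⟨w, rfl, rfl⟩ := hx; exact monomial_case w
  | zero => exact zero _
  | add x y hx hy hx' hy' => exact add _ _ _ hx hy hx' hy'
  | smul r x hx hx' => exact smul _ _ _ hx hx'

lemma dot_comm (m i j : ℕ) : dot m i j = dot m j i := by
  unfold dot; split_ifs <;> first | rfl | omega

lemma bullet_comm (μ ν : Idx m n → ℕ) : bullet μ ν = bullet ν μ := by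
  unfold bullet
  rw [Finset.sum_comm]
  refine Finset.sum_congr rfl fun i _ => Finset.sum_congr rfl fun j _ => ?_
  rw [dot_comm]; ring

lemma twist_comm (μ ν : Idx m n → ℕ) : twist μ ν = twist ν μ := by
  rw [twist, twist, bullet_comm, mul_comm (parity μ)]

lemma tens_add_left (x y z : FPrime m n) : tens (x + y) z = tens x z + tens y z := by
  simp only [tens, TensorProduct.add_tmul, map_add]

lemma tens_add_right (x y z : FPrime m n) : tens x (y + z) = tens x y + tens x z := by
  simp only [tens, TensorProduct.tmul_add, map_add]

lemma tens_smul_left (r : Kq) (x y : FPrime m n) : tens (r • x) y = r • tens x y := by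
  simp only [tens, ← TensorProduct.smul_tmul', map_smul]

lemma tens_smul_right (r : Kq) (x y : FPrime m n) : tens x (r • y) = r • tens x y := by
  simp only [tens, TensorProduct.tmul_smul, map_smul]

lemma tens_zero_left (x : FPrime m n) : tens 0 x = 0 := by
  rw [tens, TensorProduct.zero_tmul, map_zero]

lemma tens_zero_right (x : FPrime m n) : tens x 0 = 0 := by
  rw [tens, TensorProduct.tmul_zero, map_zero]

lemma tens_mul_tens_eq_twist_smul {μ ν : Idx m n → ℕ} {x₂ y₁ : FPrime m n}
    (hx : x₂ ∈ weightSpace μ) (hy : y₁ ∈ weightSpace ν) (x₁ y₂ : FPrime m n) :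
    tens x₁ x₂ * tens y₁ y₂ = twist μ ν • tens (x₁ * y₁) (x₂ * y₂) :=
  tens_mul_tens hx hy x₁ y₂

lemma one_eq_tens : (1 : TwistedSquare m n) = tens 1 1 := rfl

lemma tens_one_mul_tens (x y z : FPrime m n) : tens x 1 * tens y z = tens (x * y) z := by
  suffices h : LinearMap.mulLeft Kq (tens x 1) =
      (toTwisted m n).toLinearMap ∘ₗ (LinearMap.mulLeft Kq x).rTensor _ ∘ₗ
        (toTwisted m n).symm.toLinearMap by
    simpa [tens] using LinearMap.congr_fun h (tens y z)
  refine linearMap_ext_tens_monomial fun a b => ?_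
  rw [LinearMap.mulLeft_apply,
    tens_mul_tens_eq_twist_smul one_mem_weightSpace (monomial_mem_weightSpace a), twist_zero_left]
  simp [tens]

lemma tens_mul_one_tens (x y z : FPrime m n) : tens x y * tens 1 z = tens x (y * z) := by
  suffices h : LinearMap.mulRight Kq (tens 1 z) =
      (toTwisted m n).toLinearMap ∘ₗ (LinearMap.mulRight Kq z).lTensor _ ∘ₗ
        (toTwisted m n).symm.toLinearMap by
    simpa [tens] using LinearMap.congr_fun h (tens x y)
  refine linearMap_ext_tens_monomial fun a b => ?_
  rw [LinearMap.mulRight_apply,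
    tens_mul_tens_eq_twist_smul (monomial_mem_weightSpace b) one_mem_weightSpace, twist_zero_right]
  simp [tens]

lemma one_tens_mul_tens {μ ν : Idx m n → ℕ} {x y : FPrime m n} (hx : x ∈ weightSpace μ)
    (hy : y ∈ weightSpace ν) (z : FPrime m n) :
    tens 1 x * tens y z = twist μ ν • tens y (x * z) := by
  rw [tens_mul_tens_eq_twist_smul hx hy, one_mul]

lemma Δ_theta (i : Idx m n) : Δ m n (θ i) = tens (θ i) 1 + tens 1 (θ i) := by
  rw [Δ, θ, FreeAlgebra.lift_ι_apply]; rfl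

/-- The value of the skew derivation `skewDeriv i` on the monomial of a word. -/
def skewDerivWord (i : Idx m n) : List (Idx m n) → FPrime m n
  | [] => 0
  | j :: w => (if i = j then (1 : Kq) else 0) • monomial (FreeMonoid.ofList w) +
      twist (simple i) (simple j) • (θ j * skewDerivWord i w)

/-- The skew derivation `D_i` of `f'` with `D_i(θ_j) = δ_{ij}` and
`D_i(xy) = D_i(x) y + q^{-i • |x|} (-1)^{p(i) p(x)} x D_i(y)`. Up to the scalar `(θ_i, θ_i)` it is
adjoint to left multiplication by `θ_i`. -/
def skewDeriv (i : Idx m n) : FPrime m n →ₗ[Kq] FPrime m n :=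
  (FreeAlgebra.basisFreeMonoid Kq (Idx m n)).constr Kq fun w => skewDerivWord i w.toList

lemma skewDeriv_monomial (i : Idx m n) (w : FreeMonoid (Idx m n)) :
    skewDeriv i (monomial w) = skewDerivWord i w.toList := by
  rw [← basisFreeMonoid_eq, skewDeriv, Module.Basis.constr_basis]

lemma skewDeriv_one (i : Idx m n) : skewDeriv i 1 = 0 := by
  rw [← map_one monomial, skewDeriv_monomial]; rfl

lemma skewDeriv_theta_mul (i j : Idx m n) (x : FPrime m n) :
    skewDeriv i (θ j * x) = (if i = j then (1 : Kq) else 0) • x +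
      twist (simple i) (simple j) • (θ j * skewDeriv i x) := by
  suffices h : skewDeriv i ∘ₗ LinearMap.mulLeft Kq (θ j) = (if i = j then (1 : Kq) else 0) •
      LinearMap.id + twist (simple i) (simple j) • (LinearMap.mulLeft Kq (θ j) ∘ₗ skewDeriv i) from
    LinearMap.congr_fun h x
  refine linearMap_ext_monomial fun w => ?_
  simp only [LinearMap.comp_apply, LinearMap.mulLeft_apply, LinearMap.add_apply,
    LinearMap.smul_apply, LinearMap.id_apply]
  rw [← monomial_of_mul, skewDeriv_monomial, skewDeriv_monomial]
  rfl

lemma skewDeriv_theta (i j : Idx m n) :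
    skewDeriv i (θ j) = (if i = j then (1 : Kq) else 0) • 1 := by
  simpa only [mul_one, skewDeriv_one, mul_zero, smul_zero, add_zero] using
    skewDeriv_theta_mul i j 1

lemma skewDeriv_mul {μ : Idx m n → ℕ} (i : Idx m n) {x : FPrime m n} (hx : x ∈ weightSpace μ)
    (y : FPrime m n) :
    skewDeriv i (x * y) = skewDeriv i x * y + twist (simple i) μ • (x * skewDeriv i y) := by
  induction hx using weightSpace_induction with
  | one => simp only [one_mul, skewDeriv_one, zero_mul, twist_zero_right, one_smul, zero_add]
  | theta_mul j μ x _ ih =>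
    rw [mul_assoc, skewDeriv_theta_mul, ih, skewDeriv_theta_mul, twist_add_right]
    simp only [mul_add, add_mul, smul_mul_assoc, mul_smul_comm, smul_add, smul_smul, mul_assoc,
      add_assoc]
  | zero => simp only [zero_mul, map_zero, smul_zero, add_zero]
  | add μ a b _ _ ha hb => simp only [add_mul, map_add, ha, hb, smul_add]; abel
  | smul r μ a _ ha =>
    simp only [smul_mul_assoc, map_smul, ha, smul_add, smul_comm r (twist _ _)]

lemma skewDeriv_qBracket {μ ν : Idx m n → ℕ} (i : Idx m n) {x y : FPrime m n}
    (hx : x ∈ weightSpace μ) (hy : y ∈ weightSpace ν) (c : Kq) :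
    skewDeriv i (qBracket c x y) =
      skewDeriv i x * y + twist (simple i) μ • (x * skewDeriv i y) -
        c • (skewDeriv i y * x + twist (simple i) ν • (y * skewDeriv i x)) := by
  rw [qBracket, map_sub, map_smul, skewDeriv_mul i hx, skewDeriv_mul i hy]

lemma skewDeriv_eq_zero {μ : Idx m n → ℕ} {i : Idx m n} (hi : μ i = 0) {x : FPrime m n}
    (hx : x ∈ weightSpace μ) : skewDeriv i x = 0 := by
  induction hx using weightSpace_induction with
  | one => exact skewDeriv_one i
  | theta_mul j μ x _ ih =>
    rw [Pi.add_apply, Nat.add_eq_zero_iff, simple_apply, ite_eq_right_iff] at hi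
    have hij : i ≠ j := fun h => one_ne_zero (hi.1 h.symm)
    rw [skewDeriv_theta_mul, ih hi.2, if_neg hij, zero_smul, mul_zero, smul_zero, add_zero]
  | zero => exact map_zero _
  | add μ a b _ _ ha hb => rw [map_add, ha hi, hb hi, add_zero]
  | smul r μ a _ ha => rw [map_smul, ha hi, smul_zero]

lemma skewDeriv_mem_weightSpace {μ : Idx m n → ℕ} {i : Idx m n} {x : FPrime m n}
    (hx : x ∈ weightSpace (simple i + μ)) : skewDeriv i x ∈ weightSpace μ := by
  suffices h : ∀ {ν}, x ∈ weightSpace ν → ∀ μ, ν = simple i + μ → skewDeriv i x ∈ weightSpace μ from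
    h hx μ rfl
  clear hx μ
  intro ν hx
  induction hx using weightSpace_induction with
  | one => intro μ _; rw [skewDeriv_one]; exact zero_mem _
  | theta_mul j ν x hx ih =>
    intro μ hμ
    rw [skewDeriv_theta_mul]
    obtain rfl | hij := eq_or_ne i j
    · obtain rfl := add_left_cancel hμ
      refine add_mem (Submodule.smul_mem _ _ hx) (Submodule.smul_mem _ _ ?_)
      obtain h0 | h0 := eq_or_ne (ν i) 0
      · rw [skewDeriv_eq_zero h0 hx, mul_zero]; exact zero_mem _
      · obtain ⟨ν', hν'⟩ := exists_eq_simple_add h0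
        exact hν' ▸ mul_mem_weightSpace (theta_mem_weightSpace i) (ih ν' hν')
    · have hμj : μ j ≠ 0 := by
        have hj := congrFun hμ j
        simp only [Pi.add_apply, simple_apply, if_neg hij, if_pos] at hj
        omega
      obtain ⟨μ', rfl⟩ := exists_eq_simple_add hμj
      rw [if_neg hij, zero_smul, zero_add]
      exact Submodule.smul_mem _ _ (mul_mem_weightSpace (theta_mem_weightSpace j)
        (ih μ' (add_left_cancel (hμ.trans (add_left_comm _ _ _)))))
  | zero => intro μ _; rw [map_zero]; exact zero_mem _
  | add _ a b _ _ ha hb => intro μ hμ; rw [map_add]; exact add_mem (ha μ hμ) (hb μ hμ)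
  | smul r _ a _ ha => intro μ hμ; rw [map_smul]; exact Submodule.smul_mem _ r (ha μ hμ)

lemma skewDeriv_eq_zero_or_mem_weightSpace {μ : Idx m n → ℕ} (i : Idx m n) {x : FPrime m n}
    (hx : x ∈ weightSpace μ) :
    skewDeriv i x = 0 ∨ ∃ ν, μ = simple i + ν ∧ skewDeriv i x ∈ weightSpace ν := by
  obtain hi | hi := eq_or_ne (μ i) 0
  · exact .inl (skewDeriv_eq_zero hi hx)
  · obtain ⟨ν, rfl⟩ := exists_eq_simple_add hi
    exact .inr ⟨ν, rfl, skewDeriv_mem_weightSpace hx⟩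

/-! ### The bilinear form -/

/-- The scalar `(θ_i, θ_i)`. -/
def formCoeff (i : Idx m n) : Kq := if (i : ℕ) = m then 1 else 1 / (1 - q ^ dot m i i)

/-- The right action of `f'` on itself in which `θ_i` acts by `(θ_i, θ_i) D_i`. -/
def skewDerivAction (m n : ℕ) : FPrime m n →ₐ[Kq] (Module.End Kq (FPrime m n))ᵐᵒᵖ :=
  FreeAlgebra.lift Kq fun i => MulOpposite.op (formCoeff i • skewDeriv i)

/-- The counit `f' → ℚ(q)`, which annihilates all `θ_i`. -/
def counit (m n : ℕ) : FPrime m n →ₐ[Kq] Kq := FreeAlgebra.algebraMapInv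

lemma counit_theta (i : Idx m n) : counit m n (θ i) = 0 := by
  rw [counit, θ, FreeAlgebra.algebraMapInv, FreeAlgebra.lift_ι_apply, Pi.zero_apply]

/-- The bilinear form `( , )` on `f'`: the pairing `(x, θ_{i₁} ⋯ θ_{i_r})` is obtained by applying
`D_{i₁}, …, D_{i_r}` successively to `x`, with the factors `(θ_i, θ_i)`, and then the counit. -/
def form (m n : ℕ) : LinearMap.BilinForm Kq (FPrime m n) :=
  LinearMap.mk₂ Kq (fun x y => counit m n ((skewDerivAction m n y).unop x))
    (by simp) (by simp) (by simp) (by simp)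

lemma form_apply_one (x : FPrime m n) : form m n x 1 = counit m n x := by
  simp only [form, LinearMap.mk₂_apply, map_one, MulOpposite.unop_one, Module.End.one_apply]

lemma form_theta_mul (i : Idx m n) (x y : FPrime m n) :
    form m n x (θ i * y) = formCoeff i * form m n (skewDeriv i x) y := by
  simp [form, skewDerivAction, θ]

lemma form_theta_theta (i j : Idx m n) :
    form m n (θ i) (θ j) = if i = j then formCoeff i else 0 := by
  rw [← mul_one (θ j), form_theta_mul, form_apply_one, skewDeriv_theta, map_smul, map_one]
  obtain rfl | hij := eq_or_ne i j
  · simp only [if_true, one_smul, mul_one]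
  · simp only [if_neg hij, if_neg hij.symm, zero_smul, mul_zero]

lemma counit_eq_zero {μ : Idx m n → ℕ} (hμ : μ ≠ 0) {x : FPrime m n} (hx : x ∈ weightSpace μ) :
    counit m n x = 0 := by
  induction hx using weightSpace_induction with
  | one => exact absurd rfl hμ
  | theta_mul i μ x _ _ => rw [map_mul, counit_theta, zero_mul]
  | zero => exact map_zero _
  | add μ a b _ _ ha hb => rw [map_add, ha hμ, hb hμ, add_zero]
  | smul r μ a _ ha => rw [map_smul, ha hμ, smul_zero]

lemma form_eq_zero_of_weight_ne {μ ν : Idx m n → ℕ} (h : μ ≠ ν) {x y : FPrime m n}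
    (hx : x ∈ weightSpace μ) (hy : y ∈ weightSpace ν) : form m n x y = 0 := by
  induction hy using weightSpace_induction generalizing μ x with
  | one => rw [form_apply_one, counit_eq_zero h hx]
  | theta_mul i ν y _ ih =>
    rw [form_theta_mul]
    obtain h0 | ⟨μ', rfl, hx'⟩ := skewDeriv_eq_zero_or_mem_weightSpace i hx
    · rw [h0, map_zero, LinearMap.zero_apply, mul_zero]
    · rw [ih (fun h' => h (by rw [h'])) hx', mul_zero]
  | zero => exact map_zero _
  | add ν a b _ _ ha hb => rw [map_add, ha h hx, hb h hx, add_zero]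
  | smul r ν a _ ha => rw [map_smul, ha h hx, smul_zero]

/-- The operator `D_i ⊗ 1` on `f' ⊗ f'`. -/
def skewDerivLeft (i : Idx m n) : TwistedSquare m n →ₗ[Kq] TwistedSquare m n :=
  (toTwisted m n).toLinearMap ∘ₗ (skewDeriv i).rTensor _ ∘ₗ (toTwisted m n).symm.toLinearMap

lemma skewDerivLeft_tens (i : Idx m n) (x y : FPrime m n) :
    skewDerivLeft i (tens x y) = tens (skewDeriv i x) y := by
  simp only [skewDerivLeft, tens, LinearMap.comp_apply, LinearEquiv.coe_coe,
    LinearEquiv.symm_apply_apply, LinearMap.rTensor_tmul]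

lemma skewDerivLeft_Δ_theta_mul (i j : Idx m n) (t : TwistedSquare m n) :
    skewDerivLeft i (Δ m n (θ j) * t) = (if i = j then (1 : Kq) else 0) • t +
      twist (simple i) (simple j) • (Δ m n (θ j) * skewDerivLeft i t) := by
  suffices h : skewDerivLeft i ∘ₗ LinearMap.mulLeft Kq (Δ m n (θ j)) =
      (if i = j then (1 : Kq) else 0) • LinearMap.id +
        twist (simple i) (simple j) • (LinearMap.mulLeft Kq (Δ m n (θ j)) ∘ₗ skewDerivLeft i) from
    LinearMap.congr_fun h t
  refine linearMap_ext_tens_monomial fun a b => ?_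
  have ha := monomial_mem_weightSpace a
  have hj := theta_mem_weightSpace j
  simp only [LinearMap.comp_apply, LinearMap.mulLeft_apply, LinearMap.add_apply,
    LinearMap.smul_apply, LinearMap.id_apply, Δ_theta, add_mul, map_add, skewDerivLeft_tens,
    tens_one_mul_tens, one_tens_mul_tens hj ha, skewDeriv_theta_mul, map_smul,
    tens_add_left, tens_smul_left, smul_add, add_assoc]
  congr 2
  obtain h0 | ⟨ν, hν, ha'⟩ := skewDeriv_eq_zero_or_mem_weightSpace i ha
  · rw [h0, tens_zero_left, tens_zero_left, mul_zero, smul_zero, smul_zero]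
  · rw [one_tens_mul_tens hj ha', hν, twist_add_right, smul_smul, twist_comm (simple j) (simple i)]

lemma Δ_skewDeriv (i : Idx m n) (x : FPrime m n) :
    Δ m n (skewDeriv i x) = skewDerivLeft i (Δ m n x) := by
  induction x using theta_mul_induction with
  | one =>
    rw [map_one (Δ m n), one_eq_tens, skewDerivLeft_tens, skewDeriv_one, tens_zero_left,
      map_zero]
  | theta_mul j x ih =>
    rw [skewDeriv_theta_mul, map_mul (Δ m n) (θ j) x, skewDerivLeft_Δ_theta_mul, map_add, map_smul,
      map_smul, map_mul, ih]
  | add x y hx hy => simp only [map_add, hx, hy]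
  | smul r x hx => simp only [map_smul, hx]

lemma squareForm_form_tens_theta_mul (i : Idx m n) (t : TwistedSquare m n) (y z : FPrime m n) :
    squareForm (form m n) t (tens (θ i * y) z) =
      formCoeff i * squareForm (form m n) (skewDerivLeft i t) (tens y z) := by
  suffices h : (squareForm (form m n)).flip (tens (θ i * y) z) =
      formCoeff i • ((squareForm (form m n)).flip (tens y z) ∘ₗ skewDerivLeft i) from
    LinearMap.congr_fun h t
  refine linearMap_ext_tens_monomial fun a b => ?_
  simp only [LinearMap.BilinForm.flip_apply, LinearMap.smul_apply, LinearMap.comp_apply,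
    squareForm_tens, form_theta_mul, skewDerivLeft_tens, mul_assoc, smul_eq_mul]

/-- The map `ε ⊗ 1 : f' ⊗ f' → f'`, where `ε` is the counit. -/
def counitLeft (m n : ℕ) : TwistedSquare m n →ₗ[Kq] FPrime m n :=
  (TensorProduct.lid Kq _).toLinearMap ∘ₗ (counit m n).toLinearMap.rTensor _ ∘ₗ
    (toTwisted m n).symm.toLinearMap

lemma counitLeft_tens (x y : FPrime m n) : counitLeft m n (tens x y) = counit m n x • y := by
  simp [counitLeft, tens]

lemma counitLeft_Δ_theta_mul (i : Idx m n) (t : TwistedSquare m n) :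
    counitLeft m n (Δ m n (θ i) * t) = θ i * counitLeft m n t := by
  suffices h : counitLeft m n ∘ₗ LinearMap.mulLeft Kq (Δ m n (θ i)) =
      LinearMap.mulLeft Kq (θ i) ∘ₗ counitLeft m n from LinearMap.congr_fun h t
  refine linearMap_ext_tens_monomial fun a b => ?_
  have ha := monomial_mem_weightSpace a
  simp only [LinearMap.comp_apply, LinearMap.mulLeft_apply, Δ_theta, add_mul, map_add,
    tens_one_mul_tens, one_tens_mul_tens (theta_mem_weightSpace i) ha, counitLeft_tens, map_mul,
    counit_theta, zero_mul, zero_smul, zero_add, map_smul]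
  obtain h0 | h0 := eq_or_ne (weight a) 0
  · rw [h0, twist_zero_right, one_smul]
  · rw [counit_eq_zero h0 ha, zero_smul, smul_zero]

lemma counitLeft_Δ (x : FPrime m n) : counitLeft m n (Δ m n x) = x := by
  induction x using theta_mul_induction with
  | one => rw [map_one, one_eq_tens, counitLeft_tens, map_one, one_smul]
  | theta_mul j x ih => rw [map_mul, counitLeft_Δ_theta_mul, ih]
  | add x y hx hy => simp only [map_add, hx, hy]
  | smul r x hx => simp only [map_smul, hx]

lemma squareForm_form_one_tens (t : TwistedSquare m n) (z : FPrime m n) :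
    squareForm (form m n) t (tens 1 z) = form m n (counitLeft m n t) z := by
  suffices h : (squareForm (form m n)).flip (tens 1 z) =
      (form m n).flip z ∘ₗ counitLeft m n from LinearMap.congr_fun h t
  refine linearMap_ext_tens_monomial fun a b => ?_
  simp only [LinearMap.BilinForm.flip_apply, LinearMap.comp_apply, squareForm_tens, counitLeft_tens,
    form_apply_one, map_smul, smul_eq_mul]

lemma form_mul_right (x y z : FPrime m n) :
    form m n x (y * z) = squareForm (form m n) (Δ m n x) (tens y z) := by
  induction y using theta_mul_induction generalizing x with
  | one => rw [one_mul, squareForm_form_one_tens, counitLeft_Δ]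
  | theta_mul j y ih =>
    rw [mul_assoc, form_theta_mul, ih, squareForm_form_tens_theta_mul, Δ_skewDeriv]
  | add a b ha hb => simp only [add_mul, map_add, ha, hb, tens_add_left]
  | smul r a ha => simp only [smul_mul_assoc, map_smul, ha, tens_smul_left]

lemma squareForm_form_Δ_theta_mul {μ : Idx m n → ℕ} (i : Idx m n) {x : FPrime m n}
    (hx : x ∈ weightSpace μ) (y : FPrime m n) (t : TwistedSquare m n) :
    squareForm (form m n) (tens x y) (Δ m n (θ i) * t) =
      formCoeff i * squareForm (form m n) (tens (skewDeriv i x) y +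
        twist (simple i) μ • tens x (skewDeriv i y)) t := by
  suffices h : squareForm (form m n) (tens x y) ∘ₗ LinearMap.mulLeft Kq (Δ m n (θ i)) =
      formCoeff i • squareForm (form m n) (tens (skewDeriv i x) y +
        twist (simple i) μ • tens x (skewDeriv i y)) from LinearMap.congr_fun h t
  refine linearMap_ext_tens_monomial fun a b => ?_
  have ha := monomial_mem_weightSpace a
  simp only [LinearMap.comp_apply, LinearMap.mulLeft_apply, Δ_theta, add_mul, map_add,
    tens_one_mul_tens, one_tens_mul_tens (theta_mem_weightSpace i) ha, squareForm_tens, map_smul,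
    form_theta_mul, LinearMap.smul_apply, LinearMap.add_apply, smul_eq_mul]
  obtain rfl | h := eq_or_ne μ (weight a)
  · ring
  · rw [form_eq_zero_of_weight_ne h hx ha]; ring

lemma form_mul_left_of_mem_weightSpace {μ : Idx m n → ℕ} {x : FPrime m n}
    (hx : x ∈ weightSpace μ) (y z : FPrime m n) :
    form m n (x * y) z = squareForm (form m n) (tens x y) (Δ m n z) := by
  induction z using theta_mul_induction generalizing μ x y with
  | one =>
    rw [map_one (Δ m n), one_eq_tens, squareForm_tens, form_apply_one, form_apply_one,
      form_apply_one, map_mul]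
  | theta_mul i z ih =>
    have ih' : form m n (skewDeriv i x * y) z =
        squareForm (form m n) (tens (skewDeriv i x) y) (Δ m n z) := by
      obtain h0 | ⟨ν, -, hx'⟩ := skewDeriv_eq_zero_or_mem_weightSpace i hx
      · rw [h0, squareForm_eq_zero _ (.inl (map_zero _)), zero_mul, map_zero, LinearMap.zero_apply]
      · exact ih hx' y
    rw [form_theta_mul, skewDeriv_mul i hx, map_mul (Δ m n), squareForm_form_Δ_theta_mul i hx]
    simp only [map_add, map_smul, LinearMap.add_apply, LinearMap.smul_apply, ih', ih hx]
  | add a b ha hb => simp only [map_add, ha hx y, hb hx y]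
  | smul r a ha => simp only [map_smul, ha hx y]

lemma form_mul_left (x y z : FPrime m n) :
    form m n (x * y) z = squareForm (form m n) (tens x y) (Δ m n z) := by
  suffices h : (form m n).flip z ∘ₗ LinearMap.mulRight Kq y =
      (squareForm (form m n)).flip (Δ m n z) ∘ₗ (toTwisted m n).toLinearMap ∘ₗ
        (TensorProduct.mk Kq _ _).flip y from LinearMap.congr_fun h x
  exact linearMap_ext_monomial fun w =>
    form_mul_left_of_mem_weightSpace (monomial_mem_weightSpace w) y z

lemma form_isLusztigForm (m n : ℕ) : IsLusztigForm (form m n) where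
  one_one := by rw [form_apply_one, map_one]
  mul_right := form_mul_right
  mul_left := form_mul_left
  theta_self i hi := by rw [form_theta_theta, if_pos rfl, formCoeff, if_neg hi]
  theta_odd i hi := by rw [form_theta_theta, if_pos rfl, formCoeff, if_pos hi]
  theta_ne i j hij := by rw [form_theta_theta, if_neg hij]

namespace IsLusztigForm

variable {B B' : LinearMap.BilinForm Kq (FPrime m n)}

lemma one_theta (hB : IsLusztigForm B) (i : Idx m n) : B 1 (θ i) = 0 := by
  have h := hB.mul_left 1 1 (θ i)
  rwa [mul_one, Δ_theta, map_add, squareForm_tens, squareForm_tens, hB.one_one, mul_one, one_mul,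
    left_eq_add] at h

lemma theta_one (hB : IsLusztigForm B) (i : Idx m n) : B (θ i) 1 = 0 := by
  have h := hB.mul_right (θ i) 1 1
  rwa [mul_one, Δ_theta, map_add, LinearMap.add_apply, squareForm_tens, squareForm_tens, hB.one_one,
    mul_one, one_mul, left_eq_add] at h

lemma one_left_unique (hB : IsLusztigForm B) (hB' : IsLusztigForm B') : B 1 = B' 1 := by
  ext x
  induction x using theta_mul_induction with
  | one => rw [hB.one_one, hB'.one_one]
  | theta_mul i x _ =>
    rw [hB.mul_right, hB'.mul_right, map_one, one_eq_tens, squareForm_tens, squareForm_tens,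
      hB.one_theta, hB'.one_theta, zero_mul, zero_mul]
  | add x y hx hy => simp only [map_add, hx, hy]
  | smul r x hx => simp only [map_smul, hx]

lemma theta_theta_unique (hB : IsLusztigForm B) (hB' : IsLusztigForm B') (i j : Idx m n) :
    B (θ i) (θ j) = B' (θ i) (θ j) := by
  obtain rfl | hij := eq_or_ne i j
  · obtain hi | hi := eq_or_ne (i : ℕ) m
    · rw [hB.theta_odd i hi, hB'.theta_odd i hi]
    · rw [hB.theta_self i hi, hB'.theta_self i hi]
  · rw [hB.theta_ne i j hij, hB'.theta_ne i j hij]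

lemma theta_left_unique (hB : IsLusztigForm B) (hB' : IsLusztigForm B') (i : Idx m n) :
    B (θ i) = B' (θ i) := by
  ext x
  induction x using theta_mul_induction with
  | one => rw [hB.theta_one, hB'.theta_one]
  | theta_mul j x hx =>
    rw [hB.mul_right, hB'.mul_right]
    simp only [Δ_theta, map_add, LinearMap.add_apply, squareForm_tens, hx,
      hB.theta_theta_unique hB', hB.one_left_unique hB']
  | add x y hx hy => simp only [map_add, hx, hy]
  | smul r x hx => simp only [map_smul, hx]

lemma unique (hB : IsLusztigForm B) (hB' : IsLusztigForm B') : B = B' := by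
  refine LinearMap.ext fun x => ?_
  induction x using theta_mul_induction with
  | one => exact hB.one_left_unique hB'
  | theta_mul i x hx =>
    have htens : squareForm B (tens (θ i) x) = squareForm B' (tens (θ i) x) :=
      linearMap_ext_tens_monomial fun a b => by
        rw [squareForm_tens, squareForm_tens, hx, hB.theta_left_unique hB']
    ext y
    rw [hB.mul_left, hB'.mul_left, htens]
  | add x y hx hy => simp only [map_add, hx, hy]
  | smul r x hx => simp only [map_smul, hx]

lemma flip (hB : IsLusztigForm B) : IsLusztigForm B.flip := by
  have squareForm_flip : squareForm B.flip = (squareForm B).flip :=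
    linearMap_ext_tens_monomial fun a b => linearMap_ext_tens_monomial fun c d => by
      rw [squareForm_tens]; exact (squareForm_tens B _ _ _ _).symm
  exact
    { one_one := hB.one_one
      mul_right := fun x y z => by rw [squareForm_flip]; exact hB.mul_left y z x
      mul_left := fun x y z => by rw [squareForm_flip]; exact hB.mul_right z x y
      theta_self := hB.theta_self
      theta_odd := hB.theta_odd
      theta_ne := fun i j hij => hB.theta_ne j i hij.symm }

lemma eq_form (hB : IsLusztigForm B) : B = form m n := hB.unique (form_isLusztigForm m n)

end IsLusztigForm

lemma form_comm (x y : FPrime m n) : form m n x y = form m n y x :=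
  LinearMap.congr_fun₂ ((form_isLusztigForm m n).unique (form_isLusztigForm m n).flip) x y

/-! ### The Serre relations modulo the radical -/

variable {B : LinearMap.BilinForm Kq (FPrime m n)}

lemma toFAlg_eq_zero_iff (hB : IsLusztigForm B) {x : FPrime m n} :
    toFAlg hB x = 0 ↔ x ∈ radical hB :=
  ringCon_mk_eq_zero_iff _

lemma toFAlg_eq_zero_of_skewDeriv (hB : IsLusztigForm B) {x : FPrime m n}
    (hx : counit m n x = 0) (h : ∀ i, toFAlg hB (skewDeriv i x) = 0) : toFAlg hB x = 0 := by
  obtain rfl := hB.eq_form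
  simp only [toFAlg_eq_zero_iff, mem_radical] at h ⊢
  intro y
  induction y using theta_mul_induction with
  | one => rw [form_apply_one, hx]
  | theta_mul i y _ => rw [form_theta_mul, h i y, mul_zero]
  | add a b ha hb => rw [map_add, ha, hb, add_zero]
  | smul r a ha => rw [map_smul, ha, smul_zero]

/-- The first condition makes `D_i` vanish on the bracket of `θ_i` and `y` up to its values on `y`,
and the second one takes care of these. -/
lemma qCommute_toFAlg_theta_of_skewDeriv (hB : IsLusztigForm B) {i : Idx m n} {ν : Idx m n → ℕ}
    {y : FPrime m n} (hy : y ∈ weightSpace ν) {c : Kq} (hc : c * twist (simple i) ν = 1)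
    (h : ∀ k, twist (simple k) (simple i) • (toFAlg hB (θ i) * toFAlg hB (skewDeriv k y)) =
      c • (toFAlg hB (skewDeriv k y) * toFAlg hB (θ i))) :
    QCommute c (toFAlg hB (θ i)) (toFAlg hB y) := by
  rw [← qBracket_eq_zero_iff, ← map_qBracket]
  refine toFAlg_eq_zero_of_skewDeriv hB ?_ fun k => ?_
  · rw [map_qBracket, counit_theta, qBracket, zero_mul, mul_zero, smul_zero, sub_zero]
  rw [skewDeriv_qBracket k (theta_mem_weightSpace i) hy, skewDeriv_theta]
  simp only [map_sub, map_add, map_smul, map_mul, smul_mul_assoc, mul_smul_comm, one_mul,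
    mul_one, h, smul_add, smul_smul]
  obtain rfl | hk := eq_or_ne k i
  · simp only [if_true, mul_one, one_smul, hc]
    abel
  · simp only [if_neg hk, zero_smul, mul_zero, zero_add, add_zero, sub_self]

lemma bullet_simple_simple (i j : Idx m n) : bullet (simple i) (simple j) = dot m i j := by
  simp [bullet, simple_apply]

lemma parity_simple (i : Idx m n) : parity (simple i) = if (i : ℕ) = m then 1 else 0 := by
  rw [parity, Finset.sum_eq_single i]
  · simp [simple_apply]
  · intro j _ hj
    simp [simple_apply, Ne.symm hj]
  · simp

lemma sgn_one : sgn 1 = -1 := pow_one _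

lemma twist_simple_simple (i j : Idx m n) :
    twist (simple i) (simple j) =
      q ^ (-dot m i j) * if (i : ℕ) = m ∧ (j : ℕ) = m then -1 else 1 := by
  rw [twist, bullet_simple_simple, parity_simple, parity_simple]
  split_ifs <;> simp_all [sgn_one, sgn_zero]

lemma dot_far {i j : ℕ} (hij : i + 1 < j) : dot m i j = 0 := by
  rw [dot, if_neg (by omega), if_neg (by omega)]

lemma dot_succ (m i : ℕ) : dot m i (i + 1) = if i + 1 ≤ m then -1 else 1 := by
  rw [dot, if_neg (by omega), if_pos (.inl rfl)]
  exact if_congr (by omega) rfl rfl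

lemma dot_self_eq_neg_two_mul {i j : ℕ} (hi : i ≠ m) (hij : i + 1 = j ∨ j + 1 = i) :
    dot m i i = -(2 * dot m i j) := by
  unfold dot
  split_ifs <;> omega

lemma twist_simple_far {i j : Idx m n} (hij : (i : ℕ) + 1 < j) :
    twist (simple i) (simple j) = 1 := by
  rw [twist_simple_simple, dot_far hij, if_neg (by omega), neg_zero, zpow_zero, one_mul]

lemma twist_simple_succ {i j : Idx m n} (hij : (i : ℕ) + 1 = j) :
    twist (simple i) (simple j) = (braidCoeff m q j)⁻¹ := by
  rw [twist_simple_simple, if_neg (by omega), mul_one, ← hij, dot_succ, braidCoeff]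
  split_ifs
  · rw [neg_neg, zpow_one, inv_inv]
  · exact zpow_neg_one q

lemma twist_simple_odd {i : Idx m n} (hi : (i : ℕ) = m) :
    twist (simple i) (simple i) = -1 := by
  simp [twist_simple_simple, dot, hi]

lemma twist_simple_even {i j : Idx m n} (hi : (i : ℕ) ≠ m)
    (hij : (i : ℕ) + 1 = j ∨ (j : ℕ) + 1 = i) :
    twist (simple i) (simple i) = (twist (simple i) (simple j))⁻¹ ^ 2 := by
  rw [twist_simple_simple, twist_simple_simple, if_neg fun h => hi h.1, if_neg fun h => hi h.1,
    dot_self_eq_neg_two_mul hi hij, mul_one, mul_one, ← zpow_neg, neg_neg, neg_neg, two_mul,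
    zpow_add₀ q_ne_zero, sq]

lemma twist_ne_zero (μ ν : Idx m n → ℕ) : twist μ ν ≠ 0 :=
  mul_ne_zero (zpow_ne_zero _ q_ne_zero) (pow_ne_zero _ (neg_ne_zero.2 one_ne_zero))

lemma q_add_inv_eq_twist {i j : Idx m n} (hij : (i : ℕ) + 1 = j ∨ (j : ℕ) + 1 = i) :
    q + q⁻¹ = twist (simple i) (simple j) + (twist (simple i) (simple j))⁻¹ := by
  obtain h | h := hij
  · rw [twist_simple_succ h, inv_inv, add_comm _ (braidCoeff m q j), ← q_add_inv_eq]
  · rw [twist_comm, twist_simple_succ h, inv_inv, add_comm _ (braidCoeff m q i), ← q_add_inv_eq]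

lemma skewDeriv_qBracket_theta_theta (i j : Idx m n) (c : Kq) (k : Idx m n) :
    skewDeriv k (qBracket c (θ i) (θ j)) =
      (if k = i then 1 - c * twist (simple i) (simple j) else 0) • θ j +
        (if k = j then twist (simple i) (simple j) - c else 0) • θ i := by
  rw [skewDeriv_qBracket k (theta_mem_weightSpace i) (theta_mem_weightSpace j), skewDeriv_theta,
    skewDeriv_theta]
  rw [twist_comm (simple k) (simple i)]
  obtain rfl | hi := eq_or_ne k i <;> obtain rfl | hj := eq_or_ne k j
  all_goals simp only [*, if_true, if_false, sub_smul, mul_smul, one_smul, zero_smul, smul_add,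
    smul_zero, one_mul, mul_one, zero_mul, mul_zero]
  all_goals abel

lemma toFAlg_theta_mul_self (hB : IsLusztigForm B) {i : Idx m n} (hi : (i : ℕ) = m) :
    toFAlg hB (θ i) * toFAlg hB (θ i) = 0 := by
  rw [← map_mul]
  refine toFAlg_eq_zero_of_skewDeriv hB ?_ fun k => ?_
  · rw [map_mul, counit_theta, mul_zero]
  · rw [skewDeriv_theta_mul, skewDeriv_theta]
    obtain rfl | hk := eq_or_ne k i
    · simp [twist_simple_odd hi]
    · simp [hk]

lemma toFAlg_theta_comm (hB : IsLusztigForm B) {i j : Idx m n} (hij : (i : ℕ) + 1 < j) :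
    toFAlg hB (θ i) * toFAlg hB (θ j) = toFAlg hB (θ j) * toFAlg hB (θ i) := by
  rw [← qCommute_one_iff (R := Kq)]
  refine qCommute_toFAlg_theta_of_skewDeriv hB (theta_mem_weightSpace j)
    (by rw [one_mul, twist_simple_far hij]) fun k => ?_
  rw [skewDeriv_theta]
  obtain rfl | hk := eq_or_ne k j
  · simp [twist_comm, twist_simple_far hij]
  · simp [hk]

lemma cubicRel_toFAlg_theta (hB : IsLusztigForm B) {i j : Idx m n} (hi : (i : ℕ) ≠ m)
    (hij : (i : ℕ) + 1 = j ∨ (j : ℕ) + 1 = i) :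
    CubicRel q (toFAlg hB (θ i)) (toFAlg hB (θ j)) := by
  set t := twist (simple i) (simple j) with ht
  have ht₀ : t ≠ 0 := twist_ne_zero _ _
  rw [cubicRel_iff_qCommute_left (inv_ne_zero ht₀)
    (by rw [inv_inv, add_comm t⁻¹, ← q_add_inv_eq_twist hij]), inv_inv, ← map_qBracket]
  refine qCommute_toFAlg_theta_of_skewDeriv hB
    (qBracket_mem_weightSpace (theta_mem_weightSpace i) (theta_mem_weightSpace j) _) ?_ fun k => ?_
  · rw [twist_add_right, twist_simple_even hi hij, ← ht]
    field_simp
  · rw [skewDeriv_qBracket_theta_theta, ← ht, inv_mul_cancel₀ ht₀, sub_self, ite_self, zero_smul,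
      zero_add]
    obtain rfl | hk := eq_or_ne k j
    · rw [twist_comm, ← ht, if_pos rfl, map_smul, mul_smul_comm, smul_mul_assoc]
    · simp [hk]

lemma skewDeriv_qBracket_qBracket_theta {i j k : Idx m n}
    (hij : twist (simple i) (simple j) = q) (hjk : twist (simple j) (simple k) = q⁻¹)
    (hik : twist (simple i) (simple k) = 1) (l : Idx m n) :
    skewDeriv l (qBracket q (qBracket q⁻¹ (θ i) (θ j)) (θ k)) =
      (if l = j then q - q⁻¹ else 0) • (θ i * θ k - θ k * θ i) +
        (if l = k then q⁻¹ - q else 0) • qBracket q⁻¹ (θ i) (θ j) := by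
  rw [skewDeriv_qBracket l (qBracket_mem_weightSpace (theta_mem_weightSpace i)
      (theta_mem_weightSpace j) _) (theta_mem_weightSpace k), skewDeriv_qBracket_theta_theta,
    skewDeriv_theta, hij, inv_mul_cancel₀ q_ne_zero, sub_self, ite_self, zero_smul, zero_add,
    twist_comm (simple l) (simple i + simple j), twist_add_left]
  have hqq (r : Kq) : q * (q⁻¹ * r) = r := mul_inv_cancel_left₀ q_ne_zero r
  obtain rfl | hlj := eq_or_ne l j <;> obtain rfl | hlk := eq_or_ne l k
  · have hq : q = 1 := hij.symm.trans hik
    simp [*]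
  all_goals simp only [*, if_true, if_false, zero_smul, mul_zero, zero_mul, smul_zero, add_zero,
    zero_add, sub_zero, one_mul, mul_one, one_smul, smul_mul_assoc, mul_smul_comm, smul_sub,
    sub_smul, mul_sub, sub_mul, smul_smul]

lemma quarticRel_toFAlg_theta (hB : IsLusztigForm B) {i j k : Idx m n} (hi : (i : ℕ) + 1 = m)
    (hj : (j : ℕ) = m) (hk : (k : ℕ) = m + 1) :
    QuarticRel q (toFAlg hB (θ i)) (toFAlg hB (θ j)) (toFAlg hB (θ k)) := by
  have hij : twist (simple i) (simple j) = q := by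
    rw [twist_simple_succ (hi.trans hj.symm), braidCoeff, if_pos hj.le, inv_inv]
  have hjk : twist (simple j) (simple k) = q⁻¹ := by
    rw [twist_simple_succ (by omega), braidCoeff, if_neg (by omega)]
  have hik : twist (simple i) (simple k) = 1 := twist_simple_far (by omega)
  have hjj := twist_simple_odd hj
  have hcomm := toFAlg_theta_comm hB (i := i) (j := k) (by omega)
  have hsq := toFAlg_theta_mul_self hB hj
  have hW := qBracket_mem_weightSpace (theta_mem_weightSpace i) (theta_mem_weightSpace j) q⁻¹
  rw [quarticRel_iff_qCommute q_ne_zero hcomm hsq, ← map_qBracket, ← map_qBracket]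
  refine qCommute_toFAlg_theta_of_skewDeriv hB
    (qBracket_mem_weightSpace hW (theta_mem_weightSpace k) _) ?_ fun l => ?_
  · rw [twist_add_right, twist_add_right, twist_comm, hij, hjk, hjj, mul_neg_one,
      neg_one_mul, neg_mul, mul_inv_cancel₀ q_ne_zero, neg_neg]
  have hWj : toFAlg hB (qBracket q⁻¹ (θ i) (θ j)) * toFAlg hB (θ j) =
      -q⁻¹ • (toFAlg hB (θ j) * toFAlg hB (qBracket q⁻¹ (θ i) (θ j))) := by
    rw [map_qBracket]
    exact qCommute_qBracket_of_mul_self_right hsq _ _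
  rw [skewDeriv_qBracket_qBracket_theta hij hjk hik, map_add, map_smul, map_smul, map_sub, map_mul,
    map_mul, hcomm, sub_self, smul_zero, zero_add]
  obtain rfl | hl := eq_or_ne l k
  · rw [twist_comm, hjk, smul_mul_assoc, hWj, mul_smul_comm, smul_smul, smul_smul, smul_smul]
    congr 1
    ring
  · simp only [if_neg hl, zero_smul, mul_zero, zero_mul, smul_zero]

lemma toFAlg_eq_zero_of_serreRelator (hB : IsLusztigForm B) {x : FPrime m n}
    (hx : SerreRelator m n x) : toFAlg hB x = 0 := by
  cases hx with
  | quartic i j k hi hj hk =>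
    have h : QuarticRel q _ _ _ := quarticRel_toFAlg_theta hB hi hj hk
    simp only [map_sub, map_smul, map_mul]
    rw [h]
    abel
  | square i hi => rw [map_pow, sq, toFAlg_theta_mul_self hB hi]
  | comm i j hij =>
    rw [map_sub, map_mul, map_mul, sub_eq_zero]
    exact hij.elim (toFAlg_theta_comm hB) fun h => (toFAlg_theta_comm hB h).symm
  | cubic i j hi hij =>
    rw [map_sub, map_sub, map_smul, map_mul, map_mul, map_mul, map_mul, map_pow,
      cubicRel_toFAlg_theta hB hi hij]
    abel

lemma serreIdeal_le_radical (hB : IsLusztigForm B) : serreIdeal m n ≤ radical hB :=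
  TwoSidedIdeal.span_le.2 fun _ hx =>
    (toFAlg_eq_zero_iff hB).1 (toFAlg_eq_zero_of_serreRelator hB hx)

/-! ### Root vectors and their images -/

lemma mem_Icc_of_le {i j k : ℕ} (hi : 1 ≤ i) (hij : i ≤ j) (hjk : j ≤ k) :
    j ∈ Finset.Icc 1 k :=
  Finset.mem_Icc.2 ⟨hi.trans hij, hjk⟩

lemma gen_coe (i : Idx m n) : gen m n i = θ i := dif_pos i.2

lemma gen_eq_zero_or_exists_coe_eq (m n k : ℕ) : gen m n k = 0 ∨ ∃ i : Idx m n, (i : ℕ) = k := by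
  by_cases hk : k ∈ Finset.Icc 1 (m + n - 1)
  · exact .inr ⟨⟨k, hk⟩, rfl⟩
  · exact .inl (dif_neg hk)

lemma segment_coe (i : Idx m n) : segment m n i i = simple i := by
  funext k
  rw [segment, simple_apply]
  exact if_congr (by rw [Subtype.ext_iff, ← le_antisymm_iff]) rfl rfl

lemma segment_succ {i j : ℕ} (h : i ≤ j + 1) :
    segment m n i (j + 1) = segment m n i j + segment m n (j + 1) (j + 1) := by
  funext l
  simp only [segment, Pi.add_apply]
  split_ifs <;> omega

lemma gen_mem_weightSpace (k : ℕ) : gen m n k ∈ weightSpace (segment m n k k) := by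
  obtain h | ⟨i, rfl⟩ := gen_eq_zero_or_exists_coe_eq m n k
  · rw [h]
    exact zero_mem _
  · rw [gen_coe, segment_coe]
    exact theta_mem_weightSpace i

lemma rootVectorAux_mem_weightSpace (i d : ℕ) :
    rootVectorAux m n i d ∈ weightSpace (segment m n i (i + d)) := by
  induction d with
  | zero => exact gen_mem_weightSpace i
  | succ d ih =>
    rw [rootVectorAux, ← add_assoc, segment_succ (by omega)]
    exact qBracket_mem_weightSpace ih (gen_mem_weightSpace _) _

lemma parity_segment {i j : ℕ} (hi : 1 ≤ i) (hj : j ≤ m + n - 1) :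
    parity (segment m n i j) = if i ≤ m ∧ m ≤ j then 1 else 0 := by
  unfold parity segment
  split_ifs with h
  · rw [Finset.sum_eq_single ⟨m, mem_Icc_of_le hi h.1 (h.2.trans hj)⟩]
    · simp [h]
    · intro k _ hk
      rw [if_neg fun h => hk (Subtype.ext h), mul_zero]
    · simp
  · refine Finset.sum_eq_zero fun k _ => ?_
    by_cases hk : (k : ℕ) = m
    · simp [hk, h]
    · rw [if_neg hk, mul_zero]

lemma sgn_inv (ε : ZMod 2) : (sgn ε)⁻¹ = sgn ε := by
  rw [sgn, ← inv_pow, inv_neg_one]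

lemma sgn_mul_zpow_bullet (μ ν : Idx m n → ℕ) :
    sgn (parity μ * parity ν) * q ^ bullet μ ν = (twist μ ν)⁻¹ := by
  rw [twist, mul_inv, sgn_inv, zpow_neg, inv_inv, mul_comm]

lemma twist_segment_far {i j : ℕ} {k : Idx m n} (hi : 1 ≤ i) (hij : i ≤ j) (hjk : j + 1 < k) :
    twist (segment m n i j) (simple k) = 1 := by
  have hk := (Finset.mem_Icc.1 k.2).2
  induction j, hij using Nat.le_induction with
  | base =>
    rw [segment_coe ⟨i, mem_Icc_of_le hi le_rfl (by omega)⟩, twist_simple_far hjk]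
  | succ j hij ih =>
    rw [segment_succ (by omega), twist_add_left, ih (by omega), one_mul,
      segment_coe ⟨j + 1, mem_Icc_of_le hi (by omega) (by omega)⟩, twist_simple_far hjk]

lemma twist_segment_succ {i j : ℕ} {k : Idx m n} (hi : 1 ≤ i) (hij : i ≤ j) (hjk : j + 1 = k) :
    twist (segment m n i j) (simple k) = (braidCoeff m q k)⁻¹ := by
  have hk := (Finset.mem_Icc.1 k.2).2
  have hj : twist (segment m n j j) (simple k) = (braidCoeff m q k)⁻¹ := by
    rw [segment_coe ⟨j, mem_Icc_of_le hi hij (by omega)⟩, twist_simple_succ hjk]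
  obtain rfl | ⟨l, rfl, hil⟩ : i = j ∨ ∃ l, j = l + 1 ∧ i ≤ l :=
    hij.eq_or_lt.imp_right fun h => ⟨j - 1, by omega, by omega⟩
  · exact hj
  · rw [segment_succ (by omega), twist_add_left, twist_segment_far hi hil (by omega), one_mul, hj]

lemma zpow_neg_dot_self {i : ℕ} (hi : i ≠ m) : q ^ (-dot m i i) = braidCoeff m q i ^ 2 := by
  rw [dot, if_pos rfl, braidCoeff]
  obtain him | him := hi.lt_or_gt
  · rw [if_pos him, if_pos him.le, inv_pow, zpow_neg]
    rfl
  · rw [if_neg him.not_gt, if_pos him, if_neg him.not_ge, neg_neg]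
    rfl

lemma twist_segment_self {i j : ℕ} (hi : 1 ≤ i) (hij : i ≤ j) (hj : j ≤ m + n - 1)
    (hm : ¬(i ≤ m ∧ m ≤ j)) :
    twist (segment m n i j) (segment m n i j) = braidCoeff m q j ^ 2 := by
  have hself {k : Idx m n} (hk : (k : ℕ) ≠ m) :
      twist (simple k) (simple k) = braidCoeff m q k ^ 2 := by
    rw [twist_simple_simple, if_neg fun h => hk h.1, mul_one, zpow_neg_dot_self hk]
  induction j, hij using Nat.le_induction with
  | base =>
    rw [segment_coe ⟨i, mem_Icc_of_le hi le_rfl hj⟩, hself (by dsimp only; omega)]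
  | succ j hij ih =>
    have hbraid : braidCoeff m q j = braidCoeff m q (j + 1) :=
      if_congr (by omega) rfl rfl
    have hne : braidCoeff m q (j + 1) ≠ 0 := braidCoeff_ne_zero q_ne_zero _
    rw [segment_succ (by omega), segment_coe ⟨j + 1, mem_Icc_of_le hi (by omega) hj⟩,
      twist_add_left, twist_add_right, twist_add_right, twist_comm (simple _) (segment m n i j),
      twist_segment_succ hi hij rfl, ih (by omega) (by omega), hself (by dsimp only; omega), hbraid]
    field_simp

lemma rootVectorAux_zero_left (d : ℕ) : rootVectorAux m n 0 d = 0 := by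
  induction d with
  | zero => exact dif_neg (by simp)
  | succ d ih => rw [rootVectorAux, ih, zero_mul, mul_zero, smul_zero, sub_zero]

/-- Outside of the range of indices of the positive roots both sides vanish. -/
lemma rootVectorAux_succ (i d : ℕ) : rootVectorAux m n i (d + 1) =
    qBracket (braidCoeff m q (i + d + 1)) (rootVectorAux m n i d) (gen m n (i + d + 1)) := by
  rw [rootVectorAux, qBracket]
  obtain h | ⟨k, hk⟩ := gen_eq_zero_or_exists_coe_eq m n (i + d + 1)
  · rw [h, zero_mul, mul_zero, smul_zero, smul_zero]
  · obtain rfl | hi := Nat.eq_zero_or_pos i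
    · rw [rootVectorAux_zero_left, zero_mul, mul_zero, smul_zero, smul_zero]
    · rw [sgn_mul_zpow_bullet, ← hk, segment_coe,
        twist_segment_succ hi (Nat.le_add_right i d) hk.symm, inv_inv]

lemma q_pow_ne_one {k : ℕ} (hk : k ≠ 0) : q ^ k ≠ 1 := by
  intro h
  have hX : (Polynomial.X ^ k : Polynomial ℚ) = 1 :=
    IsFractionRing.injective (Polynomial ℚ) Kq (by simpa [q] using h)
  exact hk (by simpa using congrArg Polynomial.natDegree hX)

lemma braidCoeff_pow_ne_one (j : ℕ) {k : ℕ} (hk : k ≠ 0) : braidCoeff m q j ^ k ≠ 1 := by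
  unfold braidCoeff
  split_ifs
  · rw [inv_pow, ne_eq, inv_eq_one]
    exact q_pow_ne_one hk
  · exact q_pow_ne_one hk

lemma q_add_inv_ne_zero : q + q⁻¹ ≠ 0 := by
  intro h
  have hq₂ : q ^ 2 = -1 := by
    rw [sq, ← sub_eq_zero, sub_neg_eq_add, ← mul_inv_cancel₀ q_ne_zero, ← mul_add, h, mul_zero]
  exact q_pow_ne_one (k := 2 * 2) (by norm_num) (by rw [pow_mul, hq₂, neg_one_sq])

lemma serreSystem_of_serreRelator {A : Type*} [Ring A] [Algebra Kq A] (φ : FPrime m n →ₐ[Kq] A)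
    (hφ : ∀ x, SerreRelator m n x → φ x = 0) : SerreSystem m q fun k => φ (gen m n k) where
  q_ne_zero := q_ne_zero
  q_add_inv_ne_zero := q_add_inv_ne_zero
  comm i j hij := by
    obtain hi | ⟨i, rfl⟩ := gen_eq_zero_or_exists_coe_eq m n i
    · simp [hi]
    obtain hj | ⟨j, rfl⟩ := gen_eq_zero_or_exists_coe_eq m n j
    · simp [hj]
    simpa [gen_coe, sub_eq_zero] using hφ _ (.comm i j (.inl hij))
  square := by
    obtain hm | ⟨i, hi⟩ := gen_eq_zero_or_exists_coe_eq m n m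
    · simp [hm]
    · have h := hφ _ (.square i hi)
      rwa [map_pow, sq, ← gen_coe, hi] at h
  cubic i j him hij := by
    obtain hi | ⟨i, rfl⟩ := gen_eq_zero_or_exists_coe_eq m n i
    · simp [CubicRel, hi]
    obtain hj | ⟨j, rfl⟩ := gen_eq_zero_or_exists_coe_eq m n j
    · simp [CubicRel, hj]
    have h := hφ _ (.cubic i j him hij)
    simp only [map_sub, map_smul, map_mul, map_pow] at h
    simpa only [CubicRel, gen_coe, sub_sub, sub_eq_zero] using h
  quartic k hk := by
    obtain hi | ⟨i, rfl⟩ := gen_eq_zero_or_exists_coe_eq m n k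
    · simp [QuarticRel, hi]
    obtain hl | ⟨l, hl⟩ := gen_eq_zero_or_exists_coe_eq m n (m + 1)
    · simp [QuarticRel, hl]
    obtain hj | ⟨j, hj⟩ := gen_eq_zero_or_exists_coe_eq m n m
    · simp [QuarticRel, hj]
    have h := hφ _ (.quartic i j l hk hj hl)
    simp only [map_sub, map_smul, map_mul] at h
    have hgj := gen_coe j
    rw [hj] at hgj
    simpa only [QuarticRel, ← hl, gen_coe, hgj, sub_sub, sub_eq_zero] using h

lemma map_rootVectorAux {A : Type*} [Ring A] [Algebra Kq A] (φ : FPrime m n →ₐ[Kq] A) (i d : ℕ) :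
    φ (rootVectorAux m n i d) = rootVec m q (fun k => φ (gen m n k)) i (i + d) := by
  induction d with
  | zero => rw [Nat.add_zero, rootVec_self, rootVectorAux]
  | succ d ih => rw [rootVectorAux_succ, map_qBracket, ih, ← add_assoc, rootVec_succ (by omega)]

namespace PosRoot

/-- The first index `i` of the root `α_i + ⋯ + α_j`, as a natural number. -/
abbrev fst (α : PosRoot m n) : ℕ := (ofLex α.1).1

/-- The last index `j` of the root `α_i + ⋯ + α_j`, as a natural number. -/
abbrev snd (α : PosRoot m n) : ℕ := (ofLex α.1).2

lemma fst_le_snd (α : PosRoot m n) : α.fst ≤ α.snd := α.2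

lemma one_le_fst (α : PosRoot m n) : 1 ≤ α.fst := (Finset.mem_Icc.1 (ofLex α.1).1.2).1

lemma snd_le (α : PosRoot m n) : α.snd ≤ m + n - 1 := (Finset.mem_Icc.1 (ofLex α.1).2.2).2

lemma lt_iff {α β : PosRoot m n} :
    α < β ↔ α.fst < β.fst ∨ α.fst = β.fst ∧ α.snd < β.snd := by
  rw [← Subtype.coe_lt_coe, Prod.Lex.lt_iff, Subtype.ext_iff]
  rfl

lemma exists_eq {i j : ℕ} (hi : 1 ≤ i) (hij : i ≤ j) (hj : j ≤ m + n - 1) :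
    ∃ α : PosRoot m n, α.fst = i ∧ α.snd = j :=
  ⟨⟨toLex (⟨i, mem_Icc_of_le hi le_rfl (hij.trans hj)⟩, ⟨j, mem_Icc_of_le hi hij hj⟩), hij⟩,
    rfl, rfl⟩

lemma parity_eq_one_iff {α : PosRoot m n} : α.parity = 1 ↔ α.fst ≤ m ∧ m ≤ α.snd := by
  rw [PosRoot.parity, parity_segment α.one_le_fst α.snd_le]
  split_ifs with h <;> simp [h]

end PosRoot

lemma map_rootVector {A : Type*} [Ring A] [Algebra Kq A] (φ : FPrime m n →ₐ[Kq] A)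
    (α : PosRoot m n) :
    φ (rootVector α) = rootVec m q (fun k => φ (gen m n k)) α.fst α.snd := by
  rw [rootVector, map_rootVectorAux, Nat.add_sub_cancel' α.fst_le_snd]

lemma map_rootVector_mem_movable {A : Type*} [Ring A] [Algebra Kq A] {φ : FPrime m n →ₐ[Kq] A}
    (H : SerreSystem m q fun k => φ (gen m n k)) {U : Subalgebra Kq A} {β γ : PosRoot m n}
    (hβγ : β < γ) (hU : ∀ δ, β < δ → φ (rootVector δ) ∈ U) :
    φ (rootVector γ) ∈ movable U (φ (rootVector β)) := by
  have hroot {s j : ℕ} (hs : 1 ≤ s) (hsj : s ≤ j) (hj : j ≤ γ.snd)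
      (h : β.fst < s ∨ β.fst = s ∧ β.snd < j) :
      rootVec m q (fun k => φ (gen m n k)) s j ∈ U := by
    obtain ⟨δ, rfl, rfl⟩ := PosRoot.exists_eq hs hsj (hj.trans γ.snd_le)
    rw [← map_rootVector]
    exact hU δ (PosRoot.lt_iff.2 h)
  obtain hfst | ⟨hfst, hsnd⟩ := PosRoot.lt_iff.1 hβγ
  · rw [map_rootVector, map_rootVector]
    refine H.rootVec_mem_movable β.fst_le_snd hfst γ.fst_le_snd (fun k hk hkγ => ?_) fun h => ?_
    · rw [← rootVec_self (m := m) (q := q) (g := fun k => φ (gen m n k)) k]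
      exact hroot (γ.one_le_fst.trans hk) le_rfl hkγ (.inl (hfst.trans_le hk))
    · exact hroot β.one_le_fst (β.fst_le_snd.trans (Nat.le_succ _)) h
        (.inr ⟨rfl, Nat.lt_succ_self _⟩)
  · obtain ⟨ξ, hξ, h⟩ := H.rootVec_row β.fst_le_snd hsnd
    rw [hfst, ← map_rootVector, ← hfst, ← map_rootVector] at h
    exact (h.symm (inv_mul_cancel₀ hξ)).mem_movable (hU γ hβγ)

lemma adjoin_range_rootVector :
    Algebra.adjoin Kq (Set.range (rootVector (m := m) (n := n))) = ⊤ := by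
  refine Algebra.eq_top_iff.2 fun x => ?_
  induction x using theta_mul_induction with
  | one => exact one_mem _
  | theta_mul i x ih =>
    have hi := Finset.mem_Icc.1 i.2
    obtain ⟨α, hfst, hsnd⟩ := PosRoot.exists_eq hi.1 le_rfl hi.2
    have hα : rootVector α = θ i := by
      have h := map_rootVector (AlgHom.id Kq _) α
      rwa [hfst, hsnd, rootVec_self, AlgHom.id_apply, AlgHom.id_apply, gen_coe] at h
    exact mul_mem (Algebra.subset_adjoin ⟨α, hα⟩) ih
  | add a b ha hb => exact add_mem ha hb
  | smul r a ha => exact Subalgebra.smul_mem _ ha r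

lemma map_pbwMonomial {A : Type*} [Ring A] [Algebra Kq A] (φ : FPrime m n →ₐ[Kq] A)
    (e : PosRoot m n → ℕ) : φ (pbwMonomial e) =
      (((Finset.univ : Finset (PosRoot m n)).sort (· ≤ ·)).map
        fun α => φ (rootVector α) ^ e α).prod := by
  simp only [pbwMonomial, map_list_prod, List.map_map, Function.comp_def, map_pow]

lemma map_pbwMonomial_eq_zero {A : Type*} [Ring A] [Algebra Kq A] {φ : FPrime m n →ₐ[Kq] A}
    (H : SerreSystem m q fun k => φ (gen m n k)) {e : PosRoot m n → ℕ} {α : PosRoot m n}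
    (hα : α.parity = 1) (he : 1 < e α) : φ (pbwMonomial e) = 0 := by
  rw [map_pbwMonomial]
  refine List.prod_eq_zero (List.mem_map.2 ⟨α, (Finset.mem_sort _).2 (Finset.mem_univ α), ?_⟩)
  obtain ⟨hfst, hsnd⟩ := PosRoot.parity_eq_one_iff.1 hα
  exact pow_eq_zero_of_le he (by rw [sq, map_rootVector, H.rootVec_mul_self hfst hsnd])

lemma span_pbwMonomial_sup_ker {A : Type*} [Ring A] [Algebra Kq A] {φ : FPrime m n →ₐ[Kq] A}
    (H : SerreSystem m q fun k => φ (gen m n k)) :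
    Submodule.span Kq (Set.range fun e : PBWExponent m n => pbwMonomial e.1) ⊔
      LinearMap.ker φ.toLinearMap = ⊤ := by
  have hspan := adjoin_le_span_prod_map_pow (R := Kq) (f := fun α => φ (rootVector α))
    (Finset.sortedLT_sort (Finset.univ : Finset (PosRoot m n))).pairwise
    fun β _ γ _ hβγ => map_rootVector_mem_movable H hβγ fun δ hδ =>
      Algebra.subset_adjoin ⟨δ, ⟨(Finset.mem_sort _).2 (Finset.mem_univ δ), hδ⟩, rfl⟩
  simp only [Finset.mem_sort, Finset.mem_univ, Set.ofPred_true, Set.image_univ,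
    Set.range_comp' φ rootVector, ← AlgHom.map_adjoin, adjoin_range_rootVector,
    ← map_pbwMonomial] at hspan
  rw [← Submodule.comap_map_eq, eq_top_iff, Submodule.map_span, ← Set.range_comp]
  refine fun x _ => Submodule.mem_comap.2 <| Submodule.span_le.2 ?_ (hspan ⟨x, trivial, rfl⟩)
  rintro _ ⟨e, rfl⟩
  by_cases he : ∀ α : PosRoot m n, α.parity = 1 → e α ≤ 1
  · exact Submodule.subset_span ⟨⟨e, he⟩, rfl⟩
  · push Not at he
    obtain ⟨α, hα, hlt⟩ := he
    change φ (pbwMonomial e) ∈ _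
    rw [map_pbwMonomial_eq_zero H hα hlt]
    exact zero_mem _

/-! ### Orthogonality of ordered monomials -/

/-- The span of the tensors `u ⊗ v` with `u` homogeneous of a weight in `S`, used to control the
first tensor factors in a comultiplication. -/
def firstWeight (S : Set (Idx m n → ℕ)) : Submodule Kq (TwistedSquare m n) :=
  Submodule.span Kq {t | ∃ μ ∈ S, ∃ u ∈ weightSpace μ, ∃ v, tens u v = t}

lemma tens_mem_firstWeight {S : Set (Idx m n → ℕ)} {μ : Idx m n → ℕ} (hμ : μ ∈ S)
    {u : FPrime m n} (hu : u ∈ weightSpace μ) (v : FPrime m n) : tens u v ∈ firstWeight S :=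
  Submodule.subset_span ⟨μ, hμ, u, hu, v, rfl⟩

lemma firstWeight_mono {S S' : Set (Idx m n → ℕ)} (h : S ⊆ S') :
    firstWeight S ≤ firstWeight S' :=
  Submodule.span_mono fun _ ⟨μ, hμ, ht⟩ => ⟨μ, h hμ, ht⟩

lemma tens_mul_tens_mem_firstWeight {S : Set (Idx m n → ℕ)} {μ ν : Idx m n → ℕ}
    (h : μ + ν ∈ S) {x₁ y₁ : FPrime m n} (hx : x₁ ∈ weightSpace μ) (hy : y₁ ∈ weightSpace ν)
    (x₂ y₂ : FPrime m n) : tens x₁ x₂ * tens y₁ y₂ ∈ firstWeight S := by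
  have hx₂ : x₂ ∈ Submodule.span Kq (Set.range (monomial (m := m) (n := n))) := by
    rw [span_range_monomial]
    trivial
  induction hx₂ using Submodule.span_induction with
  | mem x hx₂ =>
    obtain ⟨w, rfl⟩ := hx₂
    rw [tens_mul_tens_eq_twist_smul (monomial_mem_weightSpace w) hy]
    exact Submodule.smul_mem _ _ (tens_mem_firstWeight h (mul_mem_weightSpace hx hy) _)
  | zero =>
    rw [tens_zero_right, zero_mul]
    exact zero_mem _
  | add a b _ _ ha hb =>
    rw [tens_add_right, add_mul]
    exact add_mem ha hb
  | smul r a _ ha =>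
    rw [tens_smul_right, smul_mul_assoc]
    exact Submodule.smul_mem _ _ ha

lemma mul_mem_firstWeight {S S' S'' : Set (Idx m n → ℕ)}
    (h : ∀ μ ∈ S, ∀ ν ∈ S', μ + ν ∈ S'') {t t' : TwistedSquare m n} (ht : t ∈ firstWeight S)
    (ht' : t' ∈ firstWeight S') : t * t' ∈ firstWeight S'' := by
  have hmul := Submodule.mul_mem_mul ht ht'
  rw [firstWeight, firstWeight, Submodule.span_mul_span] at hmul
  refine Submodule.span_le.2 ?_ hmul
  rintro _ ⟨_, ⟨μ, hμ, u, hu, v, rfl⟩, _, ⟨ν, hν, u', hu', v', rfl⟩, rfl⟩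
  exact tens_mul_tens_mem_firstWeight (h μ hμ ν hν) hu hu' v v'

lemma squareForm_eq_zero_of_mem_firstWeight {S : Set (Idx m n → ℕ)} {μ : Idx m n → ℕ}
    (hμ : μ ∉ S) {u : FPrime m n} (hu : u ∈ weightSpace μ) (v : FPrime m n)
    {t : TwistedSquare m n} (ht : t ∈ firstWeight S) :
    squareForm (form m n) (tens u v) t = 0 := by
  suffices h : firstWeight S ≤ LinearMap.ker (squareForm (form m n) (tens u v)) from h ht
  refine Submodule.span_le.2 ?_
  rintro _ ⟨ν, hν, u', hu', w, rfl⟩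
  rw [SetLike.mem_coe, LinearMap.mem_ker, squareForm_tens,
    form_eq_zero_of_weight_ne (ne_of_mem_of_not_mem hν hμ).symm hu hu', zero_mul]

/-- The reduced comultiplication `Δ x - x ⊗ 1 - 1 ⊗ x`, which vanishes on primitive elements. -/
def reducedΔ (x : FPrime m n) : TwistedSquare m n := Δ m n x - tens x 1 - tens 1 x

lemma Δ_eq_add_reducedΔ (x : FPrime m n) :
    Δ m n x = tens x 1 + tens 1 x + reducedΔ x := by
  rw [reducedΔ]
  abel

lemma reducedΔ_theta (i : Idx m n) : reducedΔ (θ i) = 0 := by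
  rw [reducedΔ, Δ_theta, add_sub_cancel_left, sub_self]

lemma reducedΔ_qBracket {μ ν : Idx m n → ℕ} {x y : FPrime m n} (hx : x ∈ weightSpace μ)
    (hy : y ∈ weightSpace ν) (hy₀ : reducedΔ y = 0) {c : Kq} (hc : c * twist ν μ = 1) :
    reducedΔ (qBracket c x y) =
      (twist μ ν - c) • tens y x + qBracket c (reducedΔ x) (Δ m n y) := by
  have hΔy : Δ m n y = tens y 1 + tens 1 y := by rw [Δ_eq_add_reducedΔ, hy₀, add_zero]
  have left : qBracket c (tens x 1) (Δ m n y) = tens (qBracket c x y) 1 := by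
    rw [qBracket, hΔy, mul_add, add_mul, tens_one_mul_tens, tens_one_mul_tens, tens_one_mul_tens,
      mul_one, one_tens_mul_tens hy hx, mul_one, smul_add, smul_smul, hc, one_smul, qBracket,
      sub_eq_add_neg (x * y), ← neg_smul, tens_add_left, tens_smul_left, neg_smul]
    abel
  have right : qBracket c (tens 1 x) (Δ m n y) =
      (twist μ ν - c) • tens y x + tens 1 (qBracket c x y) := by
    rw [qBracket, hΔy, mul_add, add_mul, one_tens_mul_tens hx hy, tens_mul_one_tens,
      tens_mul_one_tens, tens_mul_one_tens, one_mul, mul_one, smul_add, sub_smul, qBracket,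
      sub_eq_add_neg (x * y), ← neg_smul, tens_add_right, tens_smul_right, neg_smul]
    abel
  rw [reducedΔ, map_qBracket, Δ_eq_add_reducedΔ x, qBracket_add_left, qBracket_add_left, left,
    right]
  abel

lemma form_mul_eq_zero {S : Set (Idx m n → ℕ)} {μ ν : Idx m n → ℕ} (hμ : μ ≠ 0) (hν : ν ≠ 0)
    (hμS : μ ∉ S) {x y z : FPrime m n} (hx : x ∈ weightSpace μ) (hy : y ∈ weightSpace ν)
    (hz : reducedΔ z ∈ firstWeight S) : form m n (x * y) z = 0 := by
  rw [form_mul_left, Δ_eq_add_reducedΔ, map_add, map_add, squareForm_tens, squareForm_tens,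
    squareForm_eq_zero_of_mem_firstWeight hμS hx y hz,
    form_eq_zero_of_weight_ne hν hy one_mem_weightSpace,
    form_eq_zero_of_weight_ne hμ hx one_mem_weightSpace, mul_zero, zero_mul, add_zero, add_zero]

/-- The nonzero weights supported on the indices greater than `i`, which are those of the first
factors in the reduced comultiplication of a root vector starting at `i`. -/
def weightsAbove (m n i : ℕ) : Set (Idx m n → ℕ) :=
  {μ | μ ≠ 0 ∧ ∀ k : Idx m n, (k : ℕ) ≤ i → μ k = 0}

lemma add_mem_weightsAbove {i : ℕ} {μ ν : Idx m n → ℕ} (hμ : μ ∈ weightsAbove m n i)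
    (hν : ν ∈ weightsAbove m n i ∪ {0}) : μ + ν ∈ weightsAbove m n i := by
  obtain hν | rfl := hν
  · exact ⟨fun h => hμ.1 (add_eq_zero.1 h).1, fun k hk => by
      rw [Pi.add_apply, hμ.2 k hk, hν.2 k hk]⟩
  · rwa [add_zero]

lemma segment_self_apply {i j : ℕ} {k : Idx m n} (hk : (k : ℕ) = i) (hij : i ≤ j) :
    segment m n i j k = 1 :=
  if_pos ⟨hk.ge, hk.trans_le hij⟩

lemma segment_apply_of_lt {i j : ℕ} {k : Idx m n} (h : (k : ℕ) < i) : segment m n i j k = 0 :=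
  if_neg fun h' => h'.1.not_gt h

lemma segment_ne_zero {i j : ℕ} (hi : 1 ≤ i) (hij : i ≤ j) (hj : j ≤ m + n - 1) :
    segment m n i j ≠ 0 := fun h =>
  one_ne_zero <| (segment_self_apply (k := ⟨i, mem_Icc_of_le hi le_rfl (hij.trans hj)⟩) rfl
    hij).symm.trans (congrFun h _)

lemma simple_ne_zero (i : Idx m n) : simple i ≠ 0 := fun h => by
  simpa [simple_apply] using congrFun h i

lemma segment_notMem_weightsAbove {i j : ℕ} (hi : 1 ≤ i) (hij : i ≤ j) (hj : j ≤ m + n - 1) :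
    segment m n i j ∉ weightsAbove m n i := fun h =>
  one_ne_zero <| (segment_self_apply (k := ⟨i, mem_Icc_of_le hi le_rfl (hij.trans hj)⟩) rfl
    hij).symm.trans (h.2 _ le_rfl)

lemma reducedΔ_rootVectorAux_mem {i d : ℕ} (hi : 1 ≤ i) (hd : i + d ≤ m + n - 1) :
    reducedΔ (rootVectorAux m n i d) ∈ firstWeight (weightsAbove m n i) := by
  induction d with
  | zero =>
    rw [rootVectorAux, gen_coe ⟨i, mem_Icc_of_le hi le_rfl hd⟩, reducedΔ_theta]
    exact zero_mem _
  | succ d ih =>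
    obtain ⟨k, hk⟩ : ∃ k : Idx m n, (k : ℕ) = i + d + 1 :=
      ⟨⟨_, mem_Icc_of_le hi (by omega) hd⟩, rfl⟩
    have hkabove : simple k ∈ weightsAbove m n i :=
      ⟨simple_ne_zero k, fun l hl => by
        rw [simple_apply, if_neg]
        rintro rfl
        omega⟩
    have hΔk : Δ m n (θ k) ∈ firstWeight (weightsAbove m n i ∪ {0}) := by
      rw [Δ_theta]
      exact add_mem (tens_mem_firstWeight (.inl hkabove) (theta_mem_weightSpace k) _)
        (tens_mem_firstWeight (.inr rfl) one_mem_weightSpace _)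
    have hc : braidCoeff m q k * twist (simple k) (segment m n i (i + d)) = 1 := by
      rw [twist_comm, twist_segment_succ hi (Nat.le_add_right i d) hk.symm,
        mul_inv_cancel₀ (braidCoeff_ne_zero q_ne_zero _)]
    rw [rootVectorAux_succ, ← hk, gen_coe, reducedΔ_qBracket (rootVectorAux_mem_weightSpace i d)
      (theta_mem_weightSpace k) (reducedΔ_theta k) hc, qBracket]
    exact add_mem
      (Submodule.smul_mem _ _ (tens_mem_firstWeight hkabove (theta_mem_weightSpace k) _))
      (sub_mem
        (mul_mem_firstWeight (fun μ hμ ν hν => add_mem_weightsAbove hμ hν) (ih (by omega)) hΔk)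
        (Submodule.smul_mem _ _ <| mul_mem_firstWeight
          (fun μ hμ ν hν => add_comm ν μ ▸ add_mem_weightsAbove hν hμ) hΔk (ih (by omega))))

lemma formCoeff_ne_zero (i : Idx m n) : formCoeff i ≠ 0 := by
  unfold formCoeff
  split_ifs with hi
  · exact one_ne_zero
  · refine one_div_ne_zero (sub_ne_zero.2 fun h => ?_)
    rw [← inv_inj, inv_one, ← zpow_neg, zpow_neg_dot_self hi] at h
    exact braidCoeff_pow_ne_one i two_ne_zero h.symm

lemma form_qBracket_theta_self {μ : Idx m n → ℕ} {x : FPrime m n} (hx : x ∈ weightSpace μ)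
    {j : Idx m n} (hj : μ j = 0) {c : Kq}
    (h : form m n (x * θ j) (qBracket c x (θ j)) = 0) :
    form m n (qBracket c x (θ j)) (qBracket c x (θ j)) =
      c * (c - twist (simple j) μ) * formCoeff j * form m n x x := by
  have hD : skewDeriv j (qBracket c x (θ j)) = (twist (simple j) μ - c) • x := by
    rw [skewDeriv_qBracket j hx (theta_mem_weightSpace j), skewDeriv_eq_zero hj hx,
      skewDeriv_theta, if_pos rfl, one_smul, zero_mul, mul_zero, smul_zero, mul_one, one_mul,
      zero_add, add_zero, sub_smul]
  have hexpand (z : FPrime m n) : form m n z (qBracket c x (θ j)) =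
      form m n z (x * θ j) - c * form m n z (θ j * x) := by
    rw [qBracket, map_sub, map_smul, smul_eq_mul]
  rw [hexpand, form_comm _ (x * θ j), h, form_theta_mul, hD, map_smul, LinearMap.smul_apply,
    smul_eq_mul]
  ring

lemma form_rootVectorAux_self_ne_zero {i d : ℕ} (hi : 1 ≤ i) (hd : i + d ≤ m + n - 1) :
    form m n (rootVectorAux m n i d) (rootVectorAux m n i d) ≠ 0 := by
  induction d with
  | zero =>
    rw [rootVectorAux, gen_coe ⟨i, mem_Icc_of_le hi le_rfl hd⟩, form_theta_theta, if_pos rfl]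
    exact formCoeff_ne_zero _
  | succ d ih =>
    obtain ⟨k, hk⟩ : ∃ k : Idx m n, (k : ℕ) = i + d + 1 :=
      ⟨⟨_, mem_Icc_of_le hi (by omega) hd⟩, rfl⟩
    have hid : i ≤ i + d := Nat.le_add_right i d
    have hx := rootVectorAux_mem_weightSpace (m := m) (n := n) i d
    have horth := form_mul_eq_zero (segment_ne_zero hi hid (by omega)) (simple_ne_zero k)
      (segment_notMem_weightsAbove hi hid (by omega)) hx (theta_mem_weightSpace k)
      (reducedΔ_rootVectorAux_mem hi hd)
    rw [rootVectorAux_succ, ← hk, gen_coe] at horth ⊢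
    have hc : braidCoeff m q k ≠ 0 := braidCoeff_ne_zero q_ne_zero _
    have hc' : braidCoeff m q k - (braidCoeff m q k)⁻¹ ≠ 0 := fun h =>
      braidCoeff_pow_ne_one k two_ne_zero (by
        rw [sq]
        nth_rw 2 [sub_eq_zero.1 h]
        exact mul_inv_cancel₀ hc)
    rw [form_qBracket_theta_self hx (if_neg (by omega)) horth, twist_comm,
      twist_segment_succ hi hid hk.symm]
    exact mul_ne_zero (mul_ne_zero (mul_ne_zero hc hc') (formCoeff_ne_zero k)) (ih (by omega))

/-- The weight of a positive root. -/
abbrev PosRoot.weight (α : PosRoot m n) : Idx m n → ℕ := segment m n α.fst α.snd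

lemma PosRoot.weight_ne_zero (α : PosRoot m n) : α.weight ≠ 0 :=
  segment_ne_zero α.one_le_fst α.fst_le_snd α.snd_le

lemma PosRoot.fst_add_snd_sub_fst (α : PosRoot m n) : α.fst + (α.snd - α.fst) = α.snd :=
  Nat.add_sub_cancel' α.fst_le_snd

lemma rootVector_mem_weightSpace (α : PosRoot m n) : rootVector α ∈ weightSpace α.weight := by
  have h := rootVectorAux_mem_weightSpace (m := m) (n := n) α.fst (α.snd - α.fst)
  rwa [α.fst_add_snd_sub_fst] at h

lemma reducedΔ_rootVector_mem (α : PosRoot m n) :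
    reducedΔ (rootVector α) ∈ firstWeight (weightsAbove m n α.fst) :=
  reducedΔ_rootVectorAux_mem α.one_le_fst (α.fst_add_snd_sub_fst.trans_le α.snd_le)

lemma form_rootVector_self_ne_zero (α : PosRoot m n) :
    form m n (rootVector α) (rootVector α) ≠ 0 :=
  form_rootVectorAux_self_ne_zero α.one_le_fst (α.fst_add_snd_sub_fst.trans_le α.snd_le)

/-- The nonzero weights which vanish at the first index of `β` or are not bounded by `β`. They
never equal `β`, and adding such a weight, `0` or `β` to one of them gives another one. -/
def negligibleWeights (β : PosRoot m n) : Set (Idx m n → ℕ) :=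
  {μ | μ ≠ 0 ∧ (μ (ofLex β.1).1 = 0 ∨ ¬ μ ≤ β.weight)}

lemma weight_notMem_negligibleWeights (β : PosRoot m n) : β.weight ∉ negligibleWeights β := by
  rintro ⟨-, h | h⟩
  · exact one_ne_zero ((segment_self_apply rfl β.fst_le_snd).symm.trans h)
  · exact h le_rfl

lemma weight_add_weight_mem_negligibleWeights (β : PosRoot m n) :
    β.weight + β.weight ∈ negligibleWeights β :=
  ⟨fun h => β.weight_ne_zero (add_eq_zero.1 h).1,
    .inr fun h => β.weight_ne_zero (le_zero_iff.1 (add_le_iff_nonpos_left.1 h))⟩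

lemma weightsAbove_subset_negligibleWeights {β : PosRoot m n} {i : ℕ} (hi : β.fst ≤ i) :
    weightsAbove m n i ⊆ negligibleWeights β := fun _ hμ => ⟨hμ.1, .inl (hμ.2 _ hi)⟩

lemma weight_mem_negligibleWeights {β γ : PosRoot m n} (h : β < γ) :
    γ.weight ∈ negligibleWeights β := by
  refine ⟨γ.weight_ne_zero, ?_⟩
  obtain hfst | ⟨-, hsnd⟩ := PosRoot.lt_iff.1 h
  · exact .inl (segment_apply_of_lt hfst)
  · refine .inr fun hle => ?_
    have hγ : γ.weight (ofLex γ.1).2 = 1 := if_pos ⟨γ.fst_le_snd, le_rfl⟩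
    have hβ : β.weight (ofLex γ.1).2 = 0 := if_neg fun h => h.2.not_gt hsnd
    exact one_ne_zero (le_zero_iff.1 (hγ.symm.trans_le ((hle _).trans_eq hβ)))

lemma add_mem_negligibleWeights {β : PosRoot m n} {μ ν : Idx m n → ℕ}
    (hμ : μ ∈ negligibleWeights β) (hν : ν ∈ negligibleWeights β ∪ {0, β.weight}) :
    μ + ν ∈ negligibleWeights β := by
  refine ⟨fun h => hμ.1 (add_eq_zero.1 h).1, ?_⟩
  obtain hμβ | hμβ := hμ.2
  · obtain ⟨-, hνβ | hνβ⟩ | rfl | rfl := hν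
    · exact .inl (by rw [Pi.add_apply, hμβ, hνβ])
    · exact .inr fun h => hνβ (le_add_self.trans h)
    · exact .inl (by rw [add_zero, hμβ])
    · exact .inr fun h => hμ.1 (le_zero_iff.1 (add_le_iff_nonpos_left.1 h))
  · exact .inr fun h => hμβ (le_self_add.trans h)

/-- `w` is a derivative of `x` with respect to the root vector `θ_β`: the comultiplication of `x` is
`1 ⊗ x + θ_β ⊗ w`, up to terms whose first factors pair to zero with `θ_β` by weight reasons. -/
def HasRootDeriv (β : PosRoot m n) (x w : FPrime m n) : Prop :=
  Δ m n x - (tens 1 x + tens (rootVector β) w) ∈ firstWeight (negligibleWeights β)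

lemma form_rootVector_mul {β : PosRoot m n} {z w : FPrime m n} (h : HasRootDeriv β z w)
    (x : FPrime m n) :
    form m n (rootVector β * x) z = form m n (rootVector β) (rootVector β) * form m n x w := by
  have hzero := squareForm_eq_zero_of_mem_firstWeight (weight_notMem_negligibleWeights β)
    (rootVector_mem_weightSpace β) x h
  rwa [map_sub, map_add, squareForm_tens, squareForm_tens, form_eq_zero_of_weight_ne
    β.weight_ne_zero (rootVector_mem_weightSpace β) one_mem_weightSpace, zero_mul, zero_add,
    sub_eq_zero, ← form_mul_left] at hzero

namespace HasRootDeriv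

variable {β γ : PosRoot m n}

lemma one (β : PosRoot m n) : HasRootDeriv β 1 0 := by
  rw [HasRootDeriv, map_one, one_eq_tens, tens_zero_right, add_zero, sub_self]
  exact zero_mem _

lemma rootVector_self (β : PosRoot m n) : HasRootDeriv β (rootVector β) 1 := by
  rw [HasRootDeriv, add_comm, ← sub_sub]
  exact firstWeight_mono (weightsAbove_subset_negligibleWeights le_rfl) (reducedΔ_rootVector_mem β)

lemma rootVector_of_lt (h : β < γ) : HasRootDeriv β (rootVector γ) 0 := by
  have hfst : β.fst ≤ γ.fst := (PosRoot.lt_iff.1 h).elim le_of_lt fun h => h.1.le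
  rw [HasRootDeriv, Δ_eq_add_reducedΔ, tens_zero_right, add_zero, add_right_comm,
    add_sub_cancel_right]
  exact add_mem
    (tens_mem_firstWeight (weight_mem_negligibleWeights h) (rootVector_mem_weightSpace γ) 1)
    (firstWeight_mono (weightsAbove_subset_negligibleWeights hfst) (reducedΔ_rootVector_mem γ))

lemma mul {μ : Idx m n → ℕ} {x y v w : FPrime m n} (hx : HasRootDeriv β x v)
    (hy : HasRootDeriv β y w) (hμ : x ∈ weightSpace μ) :
    HasRootDeriv β (x * y) (v * y + twist μ β.weight • (x * w)) := by
  have hβ := rootVector_mem_weightSpace β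
  have hleading (u u' : FPrime m n) : tens 1 u + tens (rootVector β) u' ∈
      firstWeight (negligibleWeights β ∪ {0, β.weight}) :=
    add_mem (tens_mem_firstWeight (.inr (.inl rfl)) one_mem_weightSpace u)
      (tens_mem_firstWeight (.inr (.inr rfl)) hβ u')
  have hΔy : Δ m n y ∈ firstWeight (negligibleWeights β ∪ {0, β.weight}) := by
    rw [← sub_add_cancel (Δ m n y) (tens 1 y + tens (rootVector β) w)]
    exact add_mem (firstWeight_mono Set.subset_union_left hy) (hleading y w)
  have hexpand : Δ m n (x * y) -
      (tens 1 (x * y) + tens (rootVector β) (v * y + twist μ β.weight • (x * w))) =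
        (Δ m n x - (tens 1 x + tens (rootVector β) v)) * Δ m n y +
        (tens 1 x + tens (rootVector β) v) * (Δ m n y - (tens 1 y + tens (rootVector β) w)) +
        tens (rootVector β) v * tens (rootVector β) w := by
    rw [map_mul, tens_add_right, tens_smul_right, ← one_tens_mul_tens hμ hβ, ← tens_mul_one_tens,
      ← tens_mul_one_tens]
    noncomm_ring
  rw [HasRootDeriv, hexpand]
  refine add_mem (add_mem ?_ ?_) ?_
  · exact mul_mem_firstWeight (fun _ hμ _ hν => add_mem_negligibleWeights hμ hν) hx hΔy
  · exact mul_mem_firstWeight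
      (fun μ hμ ν hν => add_comm ν μ ▸ add_mem_negligibleWeights hν hμ) (hleading x v) hy
  · exact tens_mul_tens_mem_firstWeight (weight_add_weight_mem_negligibleWeights β) hβ hβ v w

lemma rootVector_pow_mul_of_lt (h : β < γ) (k : ℕ) {y : FPrime m n} (hy : HasRootDeriv β y 0) :
    HasRootDeriv β (rootVector γ ^ k * y) 0 := by
  induction k with
  | zero => rwa [pow_zero, one_mul]
  | succ k ih =>
    have hmul := (rootVector_of_lt h).mul ih (rootVector_mem_weightSpace γ)
    rwa [zero_mul, mul_zero, smul_zero, zero_add, ← mul_assoc, ← pow_succ'] at hmul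

lemma list_prod {L : List (PosRoot m n)} (hL : ∀ γ ∈ L, β < γ) (e : PosRoot m n → ℕ) :
    HasRootDeriv β (L.map fun α => rootVector α ^ e α).prod 0 := by
  induction L with
  | nil => exact one β
  | cons γ L ih =>
    rw [List.forall_mem_cons] at hL
    rw [List.map_cons, List.prod_cons]
    exact (ih hL.2).rootVector_pow_mul_of_lt hL.1 _

lemma rootVector_pow_succ_mul (k : ℕ) {y : FPrime m n} (hy : HasRootDeriv β y 0) :
    HasRootDeriv β (rootVector β ^ (k + 1) * y)
      ((∑ i ∈ Finset.range (k + 1), twist β.weight β.weight ^ i) • (rootVector β ^ k * y)) := by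
  induction k with
  | zero =>
    have hmul := (rootVector_self β).mul hy (rootVector_mem_weightSpace β)
    simpa only [mul_zero, smul_zero, add_zero, zero_add, pow_one, pow_zero, Finset.sum_range_one,
      one_smul] using hmul
  | succ k ih =>
    have hmul := (rootVector_self β).mul ih (rootVector_mem_weightSpace β)
    rw [one_mul, mul_smul_comm, smul_smul, ← mul_assoc, ← pow_succ', ← mul_assoc, ← pow_succ']
      at hmul
    rwa [geom_sum_succ, add_smul, one_smul, add_comm (_ • _)]

end HasRootDeriv

lemma geom_sum_twist_weight_ne_zero (β : PosRoot m n) {k : ℕ} (hk : k ≠ 0)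
    (hodd : β.parity = 1 → k ≤ 1) :
    ∑ i ∈ Finset.range k, twist β.weight β.weight ^ i ≠ 0 := by
  by_cases hβ : β.parity = 1
  · obtain rfl : k = 1 := le_antisymm (hodd hβ) (Nat.one_le_iff_ne_zero.2 hk)
    rw [Finset.sum_range_one, pow_zero]
    exact one_ne_zero
  · rw [PosRoot.parity_eq_one_iff] at hβ
    rw [twist_segment_self β.one_le_fst β.fst_le_snd β.snd_le hβ]
    intro h
    have hgeom := geom_sum_mul (braidCoeff m q β.snd ^ 2) k
    rw [h, zero_mul, eq_comm, sub_eq_zero, ← pow_mul] at hgeom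
    exact braidCoeff_pow_ne_one _ (mul_ne_zero two_ne_zero hk) hgeom

lemma form_rootVector_pow_mul_ne_zero_iff {β : PosRoot m n} {a b : ℕ}
    (ha : β.parity = 1 → a ≤ 1) (hb : β.parity = 1 → b ≤ 1) {x y : FPrime m n}
    (hx : HasRootDeriv β x 0) (hy : HasRootDeriv β y 0) :
    form m n (rootVector β ^ a * x) (rootVector β ^ b * y) ≠ 0 ↔ a = b ∧ form m n x y ≠ 0 := by
  have hzero (c : ℕ) (u : FPrime m n) {v : FPrime m n} (hv : HasRootDeriv β v 0) :
      form m n (rootVector β ^ (c + 1) * u) v = 0 := by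
    rw [pow_succ', mul_assoc, form_rootVector_mul hv, map_zero, mul_zero]
  induction a generalizing b with
  | zero =>
    cases b with
    | zero => simp only [pow_zero, one_mul, true_and]
    | succ b => simp [form_comm x, hzero b y hx]
  | succ a ih =>
    cases b with
    | zero => simp [hzero a x hy]
    | succ b =>
      rw [pow_succ' _ a, mul_assoc, form_rootVector_mul (hy.rootVector_pow_succ_mul b), map_smul,
        smul_eq_mul, mul_ne_zero_iff, mul_ne_zero_iff,
        and_iff_right (form_rootVector_self_ne_zero β),
        and_iff_right (geom_sum_twist_weight_ne_zero β b.succ_ne_zero hb), Nat.succ_inj]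
      exact ih (fun h => (Nat.le_succ a).trans (ha h)) fun h => (Nat.le_succ b).trans (hb h)

lemma form_list_prod_ne_zero_iff {L : List (PosRoot m n)} (hL : L.Pairwise (· < ·))
    (e e' : PBWExponent m n) :
    form m n (L.map fun α => rootVector α ^ e.1 α).prod
      (L.map fun α => rootVector α ^ e'.1 α).prod ≠ 0 ↔ ∀ α ∈ L, e.1 α = e'.1 α := by
  induction L with
  | nil => simp [form_apply_one]
  | cons β L ih =>
    rw [List.pairwise_cons] at hL
    simp only [List.map_cons, List.prod_cons, List.forall_mem_cons]
    rw [form_rootVector_pow_mul_ne_zero_iff (e.2 β) (e'.2 β) (.list_prod hL.1 _)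
      (.list_prod hL.1 _), ih hL.2]

lemma form_pbwMonomial_ne_zero_iff (e e' : PBWExponent m n) :
    form m n (pbwMonomial e.1) (pbwMonomial e'.1) ≠ 0 ↔ e = e' := by
  rw [pbwMonomial, pbwMonomial, form_list_prod_ne_zero_iff (Finset.sortedLT_sort _).pairwise,
    Subtype.ext_iff, funext_iff]
  simp only [Finset.mem_sort, Finset.mem_univ, true_imp_iff]

lemma form_iIsOrtho_pbwMonomial :
    (form m n).iIsOrtho fun e : PBWExponent m n => pbwMonomial e.1 := fun e e' hne =>
  not_not.1 (mt (form_pbwMonomial_ne_zero_iff e e').1 hne)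

/-! ### Comparison of the two ideals -/

lemma disjoint_span_pbwMonomial_ker_toFAlg (hB : IsLusztigForm B) :
    Disjoint (Submodule.span Kq (Set.range fun e : PBWExponent m n => pbwMonomial e.1))
      (LinearMap.ker (toFAlg hB).toLinearMap) := by
  obtain rfl := hB.eq_form
  refine (disjoint_span_ker_of_iIsOrtho form_iIsOrtho_pbwMonomial fun e =>
    (form_pbwMonomial_ne_zero_iff e e).2 rfl).mono_right fun x hx => LinearMap.ext ?_
  exact (mem_radical hB x).1 ((toFAlg_eq_zero_iff hB).1 hx)

lemma span_pbwMonomial_sup_ker_mk_serreIdeal :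
    Submodule.span Kq (Set.range fun e : PBWExponent m n => pbwMonomial e.1) ⊔
      LinearMap.ker ((serreIdeal m n).ringCon.mkₐ Kq).toLinearMap = ⊤ :=
  span_pbwMonomial_sup_ker <| serreSystem_of_serreRelator _ fun _ hx =>
    (ringCon_mk_eq_zero_iff _).2 (TwoSidedIdeal.subset_span hx)

theorem radical_eq_serreIdeal (hB : IsLusztigForm B) : radical hB = serreIdeal m n := by
  have hle : LinearMap.ker ((serreIdeal m n).ringCon.mkₐ Kq).toLinearMap ≤
      LinearMap.ker (toFAlg hB).toLinearMap := fun x hx =>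
    (toFAlg_eq_zero_iff hB).2 (serreIdeal_le_radical hB ((ringCon_mk_eq_zero_iff (R := Kq) _).1 hx))
  have hker := eq_of_le_of_inf_le_of_sup_le hle
    ((disjoint_span_pbwMonomial_ker_toFAlg hB).symm.eq_bot.trans_le bot_le)
    (le_top.trans_eq ((sup_comm _ _).trans span_pbwMonomial_sup_ker_mk_serreIdeal).symm)
  ext x
  rw [← toFAlg_eq_zero_iff hB, ← ringCon_mk_eq_zero_iff (R := Kq)]
  exact (SetLike.ext_iff.1 hker x).symm

theorem exists_basis_pbwMonomial (hB : IsLusztigForm B) :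
    ∃ b : Module.Basis (PBWExponent m n) Kq (FAlg hB), ∀ e, b e = toFAlg hB (pbwMonomial e.1) := by
  have hli : LinearIndependent Kq fun e : PBWExponent m n => toFAlg hB (pbwMonomial e.1) :=
    (LinearMap.BilinForm.linearIndependent_of_iIsOrtho form_iIsOrtho_pbwMonomial fun e =>
      (form_pbwMonomial_ne_zero_iff e e).2 rfl).map (disjoint_span_pbwMonomial_ker_toFAlg hB)
  have hsurj : LinearMap.range (toFAlg hB).toLinearMap = ⊤ :=
    LinearMap.range_eq_top.2 (radical hB).ringCon.mk'_surjective
  have hspan := (LinearMap.map_eq_top_iff hsurj).2 <| span_pbwMonomial_sup_ker <|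
    serreSystem_of_serreRelator (toFAlg hB) fun _ => toFAlg_eq_zero_of_serreRelator hB
  rw [Submodule.map_span, ← Set.range_comp] at hspan
  exact ⟨.mk hli hspan.ge, Module.Basis.mk_apply hli hspan.ge⟩

end SuperPBW

end

theorem mainTheorem9 (m n : ℕ) :
    (∃! B : LinearMap.BilinForm SuperPBW.Kq (SuperPBW.FPrime m n), SuperPBW.IsLusztigForm B) ∧
    ∀ (B : LinearMap.BilinForm SuperPBW.Kq (SuperPBW.FPrime m n)) (hB : SuperPBW.IsLusztigForm B),
      (∃ b : Module.Basis (SuperPBW.PBWExponent m n) SuperPBW.Kq (SuperPBW.FAlg hB),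
        ∀ e : SuperPBW.PBWExponent m n,
          b e = SuperPBW.toFAlg hB (SuperPBW.pbwMonomial e.1)) ∧
      SuperPBW.radical hB = SuperPBW.serreIdeal m n :=
  ⟨⟨SuperPBW.form m n, SuperPBW.form_isLusztigForm m n, fun _ hB => hB.eq_form⟩,
    fun _ hB => ⟨SuperPBW.exists_basis_pbwMonomial hB, SuperPBW.radical_eq_serreIdeal hB⟩⟩
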